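/- **Theorem 2.1 (Existence/Uniqueness).** Let $K, r, \tilde a, \tilde b \in \mathbb{R}$ be constants. Let $u_{2,0} \in C^1([0,1])$, let $u_{1,0} \in H^3(0,1)$ (identified with its continuous representative, which is of class $C^2$ on $[0,1]$) satisfy $u_{1,0}(1) = u_{1,0}''(1) = 0$ and, in addition, $u_{1,0}'(0) = 0$ or $u_{1,0}''(0) = 0$, and let $d \in C^2([0,+\infty))$ satisfy $d(0) = u_{1,0}(0)$. Then there exists a unique pair of mappings $$u_1 \in C^0([0,+\infty)\times[0,1]) \cap C^1((0,+\infty)\times[0,1]), \qquad u_2 \in C^1([0,+\infty)\times[0,1]),$$ with $u_1(t,\cdot) \in C^2([0,1])$ for every $t>0$, such that $$\frac{\partial u_1}{\partial t}(t,z) - \frac{\partial^2 u_1}{\partial z^2}(t,z) + K u_1(t,z) - r\tilde b\, u_2(t,z) = 0, \qquad \frac{\partial u_2}{\partial t}(t,z) - \tilde a\, u_1(t,z) + \tilde b\, u_2(t,z) = 0$$ for all $(t,z) \in (0,+\infty)\times(0,1)$, $$u_1(t,0) = d(t), \qquad u_1(t,1) = 0 \qquad \text{for all } t \ge 0,$$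 and $$u_1(0,z) = u_{1,0}(z), \qquad u_2(0,z) = u_{2,0}(z) \qquad \text{for all } z \in [0,1].$$ Here $C^k$ on a set that contains boundary points is understood with one-sided derivatives at those points. -/

import Mathlib

open Set MeasureTheory

open scoped ContDiff

/-- `g` is a weak derivative of order `k` of `f` on the interval `(0,1)`:
`∫₀¹ f φ⁽ᵏ⁾ = (-1)ᵏ ∫₀¹ g φ` for every smooth `φ` with compact support contained in `(0,1)`. -/
def IsWeakDeriv (k : ℕ) (f g : ℝ → ℝ) : Prop :=
  ∀ φ : ℝ → ℝ, ContDiff ℝ ∞ φ → HasCompactSupport φ → tsupport φ ⊆ Ioo (0 : ℝ) 1 →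
    ∫ z in Ioo (0 : ℝ) 1, f z * iteratedDeriv k φ z
      = (-1 : ℝ) ^ k * ∫ z in Ioo (0 : ℝ) 1, g z * φ z

/-- The Sobolev space `Hᵏ(0,1)`: `f` is in `L²(0,1)`, and for every order `j ≤ k` it has a weak
derivative in `L²(0,1)`. -/
def MemSobolevH (k : ℕ) (f : ℝ → ℝ) : Prop :=
  MemLp f 2 (volume.restrict (Ioo (0 : ℝ) 1)) ∧
    ∀ j : ℕ, 1 ≤ j → j ≤ k →
      ∃ g : ℝ → ℝ, MemLp g 2 (volume.restrict (Ioo (0 : ℝ) 1)) ∧ IsWeakDeriv j f g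

/-- `(u₁, u₂)` is a classical solution of the initial-boundary value problem
`∂ₜu₁ - ∂²_z u₁ + K u₁ - r b u₂ = 0` and `∂ₜu₂ - a u₁ + b u₂ = 0` on `(0,∞) × (0,1)`,
`u₁(t,0) = d(t)` and `u₁(t,1) = 0` for `t ≥ 0`, `u₁[0] = u₁₀` and `u₂[0] = u₂₀` on `[0,1]`.
Only the values of the functions on `[0,∞) × [0,1]`, `[0,∞)` and `[0,1]` matter; regularity up to
the boundary is in the one-sided sense. -/
structure IsClassicalSolution (K r a b : ℝ) (d u₁₀ u₂₀ : ℝ → ℝ) (u₁ u₂ : ℝ → ℝ → ℝ) : Prop where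
  /-- `u₁ ∈ C⁰([0,∞) × [0,1])` -/
  continuousOn_fst : ContinuousOn (fun p : ℝ × ℝ => u₁ p.1 p.2) (Ici 0 ×ˢ Icc 0 1)
  /-- `u₁ ∈ C¹((0,∞) × [0,1])` -/
  contDiffOn_fst : ContDiffOn ℝ 1 (fun p : ℝ × ℝ => u₁ p.1 p.2) (Ioi 0 ×ˢ Icc 0 1)
  /-- `u₁[t] ∈ C²([0,1])` for `t > 0` -/
  contDiffOn_profile : ∀ t : ℝ, 0 < t → ContDiffOn ℝ 2 (u₁ t) (Icc 0 1)
  /-- `u₂ ∈ C¹([0,∞) × [0,1])` -/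
  contDiffOn_snd : ContDiffOn ℝ 1 (fun p : ℝ × ℝ => u₂ p.1 p.2) (Ici 0 ×ˢ Icc 0 1)
  parabolic : ∀ t : ℝ, 0 < t → ∀ z ∈ Ioo (0 : ℝ) 1,
    deriv (fun s => u₁ s z) t - iteratedDeriv 2 (u₁ t) z + K * u₁ t z - r * b * u₂ t z = 0
  hyperbolic : ∀ t : ℝ, 0 < t → ∀ z ∈ Ioo (0 : ℝ) 1,
    deriv (fun s => u₂ s z) t - a * u₁ t z + b * u₂ t z = 0
  boundary_zero : ∀ t : ℝ, 0 ≤ t → u₁ t 0 = d t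
  boundary_one : ∀ t : ℝ, 0 ≤ t → u₁ t 1 = 0
  initial_fst : ∀ z ∈ Icc (0 : ℝ) 1, u₁ 0 z = u₁₀ z
  initial_snd : ∀ z ∈ Icc (0 : ℝ) 1, u₂ 0 z = u₂₀ z

/-!
Existence rests on a Fourier sine expansion. Eliminating `u₂` turns the system into a heat equation
with memory, `κ = r b a`, and the source `r b e^{-bt} u₂₀(z)`. Three explicit lifts reduce it to a
problem for `y` with homogeneous boundary conditions: `(1 - z) d(t)` carries the boundary data, and
`e^{-bt} P(z)`, `q(t) Q(z)` with `P'' = -r b u₂₀`, `Q'' = 1 - z` absorb the part of the source that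
does not vanish at `z = 0, 1`. What is left of the source is `α(t) P(z) + β(t) Q(z)`, and the
initial value of `y` is a `C²` function vanishing at `0` and `1`; here the Sobolev embedding
`MemSobolevH.exists_contDiff_two_eqOn` and the compatibility conditions of order zero enter.
All these profiles have absolutely convergent sine series (`exists_hasSum_sine_series`): expand
Green's function of `-d²/dz²`, whose series is given by the Bernoulli polynomial `B₂`.

Each Fourier mode `(y, v)`, `v` being the memory variable, solves the linear system
`y' = -(ω² + K) y + κ v + s`, `v' = y - b v`. Two estimates, uniform in `ω`, make every series
converge with the required derivatives: the energy `y² + ω² v²` gains one power of `ω` for `v` up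
to `t = 0` (`mode_energy_bound`), so that `v`, hence `u₂`, is `C¹` on the closed strip; parabolic
smoothing gains two powers of `ω` for `y` at positive times (`mode_smoothing_bound`), so that `y` is
`C¹` in `(t, z)` and `C²` in `z` there.

Uniqueness is the energy method for the difference of two solutions
(`IsClassicalSolution.eq_zero`).
-/

/-! ### Antiderivatives and global extensions of one-sided smooth functions -/

theorem hasDerivAt_const_add_primitive {g : ℝ → ℝ} (hg : Continuous g) (c x : ℝ) :
    HasDerivAt (fun x => c + ∫ s in (0 : ℝ)..x, g s) (g x) x :=
  (intervalIntegral.integral_hasDerivAt_right (hg.intervalIntegrable _ _)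
    (hg.stronglyMeasurableAtFilter _ _) hg.continuousAt).const_add c

theorem contDiff_succ_of_hasDerivAt {n : ℕ} {f g : ℝ → ℝ} (hg : ContDiff ℝ n g)
    (hf : ∀ x, HasDerivAt f (g x) x) : ContDiff ℝ ((n + 1 : ℕ) : WithTop ℕ∞) f := by
  have h : deriv f = g := funext fun x => (hf x).deriv
  push_cast
  rw [contDiff_succ_iff_deriv]
  exact ⟨fun x => (hf x).differentiableAt, by simp, by rwa [h]⟩

/-- One-sided antiderivatives extend: if the one-sided derivative of `f` on the interval `S`
agrees on `S` with a globally defined `Cⁿ` function, then `f` agrees on `S` with a globally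
defined `Cⁿ⁺¹` function. -/
theorem exists_contDiff_succ_eqOn {n : ℕ} {S : Set ℝ} (hS : S.OrdConnected) (h0 : (0 : ℝ) ∈ S)
    {f g : ℝ → ℝ} (hg : ContDiff ℝ n g) (hf : ∀ x ∈ S, HasDerivWithinAt f (g x) S x) :
    ∃ F : ℝ → ℝ, ContDiff ℝ ((n + 1 : ℕ) : WithTop ℕ∞) F ∧ EqOn F f S := by
  have hF := hasDerivAt_const_add_primitive hg.continuous (f 0)
  refine ⟨_, contDiff_succ_of_hasDerivAt hg hF, ?_⟩
  have hconv : Convex ℝ S := hS.convex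
  intro x hx
  have key := hconv.is_const_of_fderivWithin_eq_zero (𝕜 := ℝ)
    (f := fun x => (f 0 + ∫ s in (0 : ℝ)..x, g s) - f x) (s := S) ?_ ?_ hx h0
  · simp only [intervalIntegral.integral_same] at key
    linarith
  · intro y hy
    exact ((hF y).hasDerivWithinAt.fun_sub (hf y hy)).differentiableWithinAt
  · intro y hy
    have h := (hF y).hasDerivWithinAt.fun_sub (hf y hy)
    rw [sub_self] at h
    by_cases hu : UniqueDiffWithinAt ℝ S y
    · have := h.hasFDerivWithinAt.fderivWithin hu
      simpa using this
    · exact fderivWithin_zero_of_not_uniqueDiffWithinAt hu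

theorem ContDiffOn.exists_contDiff_one_eqOn_Icc {f : ℝ → ℝ} (hf : ContDiffOn ℝ 1 f (Icc 0 1)) :
    ∃ F : ℝ → ℝ, ContDiff ℝ 1 F ∧ EqOn F f (Icc 0 1) := by
  rw [contDiffOn_one_iff_derivWithin (uniqueDiffOn_Icc zero_lt_one)] at hf
  -- extend the one-sided derivative by constants outside `[0,1]`
  have hg : Continuous (IccExtend zero_le_one ((Icc (0 : ℝ) 1).domRestrict
      (derivWithin f (Icc 0 1)))) :=
    (continuousOn_iff_continuous_domRestrict.1 hf.2).Icc_extend'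
  obtain ⟨F, hF, hFf⟩ := exists_contDiff_succ_eqOn (n := 0) (f := f) ordConnected_Icc
    (left_mem_Icc.2 zero_le_one) (contDiff_zero.2 hg) (fun x hx => by
      rw [IccExtend_of_mem _ _ hx]
      exact (hf.1 x hx).hasDerivWithinAt)
  exact ⟨F, by simpa using hF, hFf⟩

/-- `C²` functions on an interval `S` that is a retract of `ℝ` extend to `C²` functions on `ℝ`;
`ρ` is the retraction. -/
theorem ContDiffOn.exists_contDiff_two_eqOn {S : Set ℝ} (hS : S.OrdConnected) (h0 : (0 : ℝ) ∈ S)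
    (hu : UniqueDiffOn ℝ S) {ρ : ℝ → ℝ} (hρ : Continuous ρ) (hρS : ∀ x, ρ x ∈ S)
    (hρid : ∀ x ∈ S, ρ x = x) {f : ℝ → ℝ} (hf : ContDiffOn ℝ 2 f S) :
    ∃ F : ℝ → ℝ, ContDiff ℝ 2 F ∧ EqOn F f S := by
  rw [show (2 : WithTop ℕ∞) = 1 + 1 by norm_num, contDiffOn_succ_iff_derivWithin hu,
    contDiffOn_one_iff_derivWithin hu] at hf
  obtain ⟨hd, -, hd', hc⟩ := hf
  have hg : Continuous fun x => derivWithin (derivWithin f S) S (ρ x) :=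
    hc.comp_continuous hρ hρS
  obtain ⟨G, hG, hGf⟩ := exists_contDiff_succ_eqOn (n := 0) (f := derivWithin f S)
    hS h0 (contDiff_zero.2 hg) (fun x hx => by
      rw [hρid x hx]
      exact (hd' x hx).hasDerivWithinAt)
  obtain ⟨F, hF, hFf⟩ := exists_contDiff_succ_eqOn (n := 1) (f := f) hS h0 hG (fun x hx => by
      rw [hGf hx]
      exact (hd x hx).hasDerivWithinAt)
  exact ⟨F, by simpa using hF, hFf⟩

theorem ContDiffOn.exists_contDiff_two_eqOn_Ici {f : ℝ → ℝ} (hf : ContDiffOn ℝ 2 f (Ici 0)) :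
    ∃ F : ℝ → ℝ, ContDiff ℝ 2 F ∧ EqOn F f (Ici 0) :=
  hf.exists_contDiff_two_eqOn ordConnected_Ici self_mem_Ici (uniqueDiffOn_Ici 0)
    (ρ := fun x => max x 0) (by fun_prop) (fun x => le_max_right x 0) fun _ hx => max_eq_left hx

theorem ContDiffOn.exists_contDiff_two_eqOn_Icc {f : ℝ → ℝ} (hf : ContDiffOn ℝ 2 f (Icc 0 1)) :
    ∃ F : ℝ → ℝ, ContDiff ℝ 2 F ∧ EqOn F f (Icc 0 1) :=
  hf.exists_contDiff_two_eqOn ordConnected_Icc (left_mem_Icc.2 zero_le_one)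
    (uniqueDiffOn_Icc zero_lt_one) (ρ := fun x => projIcc 0 1 zero_le_one x)
    (continuous_subtype_val.comp (continuous_projIcc (h := zero_le_one))) (fun x => (projIcc 0 1 zero_le_one x).2)
    fun x hx => by rw [projIcc_of_mem _ hx]

/-- The one-dimensional Dirichlet problem `P'' = g`, `P(0) = P(1) = 0`. -/
theorem exists_contDiff_two_dirichlet {g : ℝ → ℝ} (hg : Continuous g) :
    ∃ P : ℝ → ℝ, ContDiff ℝ 2 P ∧ P 0 = 0 ∧ P 1 = 0 ∧ iteratedDeriv 2 P = g := by
  set G : ℝ → ℝ := fun x => 0 + ∫ s in (0 : ℝ)..x, g s with hGdef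
  have hG : ∀ x, HasDerivAt G (g x) x := hasDerivAt_const_add_primitive hg 0
  have hGc : Continuous G := continuous_iff_continuousAt.2 fun x => (hG x).continuousAt
  set H : ℝ → ℝ := fun x => 0 + ∫ s in (0 : ℝ)..x, G s with hHdef
  have hH : ∀ x, HasDerivAt H (G x) x := hasDerivAt_const_add_primitive hGc 0
  have h1 : ∀ x, HasDerivAt (fun x => H x - H 1 * x) (G x - H 1) x := fun x => by
    simpa using (hH x).fun_sub ((hasDerivAt_id' x).const_mul (H 1))
  have h2 : ∀ x, HasDerivAt (fun x => G x - H 1) (g x) x := fun x => (hG x).sub_const _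
  have hc : ContDiff ℝ ((1 : ℕ) : WithTop ℕ∞) fun x => G x - H 1 :=
    contDiff_succ_of_hasDerivAt (n := 0) (contDiff_zero.2 hg) h2
  refine ⟨fun x => H x - H 1 * x, by simpa using contDiff_succ_of_hasDerivAt hc h1,
    by simp [hHdef], by simp, ?_⟩
  rw [iteratedDeriv_succ, iteratedDeriv_one, show deriv (fun x => H x - H 1 * x) = _ from
    funext fun x => (h1 x).deriv]
  exact funext fun x => (h2 x).deriv

/-! ### Weak derivatives and the Sobolev embedding -/

/-- A smooth function supported in a compact part of `(0,1)` with zero mean is the derivative of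
another such function. -/
theorem exists_testFunction_deriv_eq {ψ : ℝ → ℝ} (hψ : ContDiff ℝ ∞ ψ) (hc : HasCompactSupport ψ)
    (hs : tsupport ψ ⊆ Ioo (0 : ℝ) 1) (h0 : ∫ z in Ioo (0 : ℝ) 1, ψ z = 0) :
    ∃ φ : ℝ → ℝ, ContDiff ℝ ∞ φ ∧ HasCompactSupport φ ∧ tsupport φ ⊆ Ioo (0 : ℝ) 1 ∧
      deriv φ = ψ := by
  obtain ⟨α, β, hα, hβ, hsub⟩ : ∃ α β : ℝ, 0 < α ∧ β < 1 ∧ tsupport ψ ⊆ Icc α β := by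
    rcases (tsupport ψ).eq_empty_or_nonempty with he | hne
    · exact ⟨1 / 2, 1 / 2, by norm_num, by norm_num, by simp [he]⟩
    · obtain ⟨α, hα⟩ := hc.isCompact.exists_isLeast hne
      obtain ⟨β, hβ⟩ := hc.isCompact.exists_isGreatest hne
      exact ⟨α, β, (hs hα.1).1, (hs hβ.1).2, fun x hx => ⟨hα.2 hx, hβ.2 hx⟩⟩
  have hz : ∀ x, x ∉ Icc α β → ψ x = 0 := fun x hx =>
    image_eq_zero_of_notMem_tsupport fun h => hx (hsub h)
  have hd := hasDerivAt_const_add_primitive hψ.continuous 0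
  have hderiv : deriv (fun x => 0 + ∫ s in (0 : ℝ)..x, ψ s) = ψ := funext fun x => (hd x).deriv
  have hsupp : tsupport (fun x => 0 + ∫ s in (0 : ℝ)..x, ψ s) ⊆ Icc α β := by
    refine closure_minimal (fun x hx => ?_) isClosed_Icc
    by_contra hxn
    apply hx
    simp only [zero_add]
    rw [mem_Icc, not_and_or, not_le, not_le] at hxn
    rcases hxn with h | h
    · refine (intervalIntegral.integral_congr (g := fun _ => 0) fun s hs' => ?_).trans (by simp)
      refine hz s fun h' => ?_
      rcases mem_uIcc.1 hs' with hs' | hs' <;> linarith [h'.1, hs'.1, hs'.2]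
    · have h1 : ∫ s in (0 : ℝ)..1, ψ s = 0 := by
        rwa [intervalIntegral.integral_of_le zero_le_one, integral_Ioc_eq_integral_Ioo]
      have h2 : ∫ s in x..1, ψ s = 0 := by
        refine (intervalIntegral.integral_congr (g := fun _ => 0) fun s hs' => ?_).trans (by simp)
        refine hz s fun h' => ?_
        rcases mem_uIcc.1 hs' with hs' | hs' <;> linarith [h'.2, hs'.1, hs'.2]
      have h3 := intervalIntegral.integral_add_adjacent_intervals (μ := volume)
        (hψ.continuous.intervalIntegrable 0 x) (hψ.continuous.intervalIntegrable x 1)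
      linarith
  refine ⟨_, ?_, ?_, hsupp.trans (Icc_subset_Ioo hα hβ), hderiv⟩
  · rw [contDiff_infty_iff_deriv, hderiv]
    exact ⟨fun x => (hd x).differentiableAt, hψ⟩
  · exact isCompact_Icc.of_isClosed_subset (isClosed_tsupport _) hsupp

theorem integrableOn_Ioo_mul_of_continuous {h φ : ℝ → ℝ} (hh : IntegrableOn h (Ioo (0 : ℝ) 1))
    (hφ : Continuous φ) : IntegrableOn (fun z => h z * φ z) (Ioo (0 : ℝ) 1) := by
  rw [← integrableOn_Icc_iff_integrableOn_Ioo] at hh ⊢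
  exact hh.mul_continuousOn hφ.continuousOn isCompact_Icc

/-- The lemma of du Bois-Reymond: an integrable function on `(0,1)` with vanishing weak derivative
is almost everywhere constant. -/
theorem ae_eq_const_of_integral_mul_deriv_eq_zero {h : ℝ → ℝ}
    (hh : IntegrableOn h (Ioo (0 : ℝ) 1))
    (H : ∀ φ : ℝ → ℝ, ContDiff ℝ ∞ φ → HasCompactSupport φ → tsupport φ ⊆ Ioo (0 : ℝ) 1 →
      ∫ z in Ioo (0 : ℝ) 1, h z * deriv φ z = 0) :
    ∃ c : ℝ, ∀ᵐ z, z ∈ Ioo (0 : ℝ) 1 → h z = c := by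
  let χ₀ : ContDiffBump (1 / 2 : ℝ) := ⟨1 / 8, 1 / 4, by norm_num, by norm_num⟩
  obtain ⟨χ, hχ, hχc, hχs, hχ1⟩ : ∃ χ : ℝ → ℝ, ContDiff ℝ ∞ χ ∧ HasCompactSupport χ ∧
      tsupport χ ⊆ Ioo (0 : ℝ) 1 ∧ ∫ z in Ioo (0 : ℝ) 1, χ z = 1 := by
    have hsub : tsupport (χ₀.normed volume) ⊆ Ioo (0 : ℝ) 1 := by
      rw [χ₀.tsupport_normed_eq, Real.closedBall_eq_Icc]
      exact Icc_subset_Ioo (by norm_num [χ₀]) (by norm_num [χ₀])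
    refine ⟨χ₀.normed volume, χ₀.contDiff_normed, χ₀.hasCompactSupport_normed, hsub, ?_⟩
    rw [setIntegral_eq_integral_of_forall_compl_eq_zero fun x hx =>
      image_eq_zero_of_notMem_tsupport fun h => hx (hsub h)]
    exact χ₀.integral_normed
  set c := ∫ z in Ioo (0 : ℝ) 1, h z * χ z with hcdef
  refine ⟨c, ?_⟩
  have key := isOpen_Ioo.ae_eq_zero_of_integral_contDiff_smul_eq_zero (μ := volume)
    (f := fun z => h z - c) (U := Ioo (0 : ℝ) 1)
    (hh.sub (by simp [IntegrableOn])).locallyIntegrableOn ?_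
  · filter_upwards [key] with z hz hz'
    linarith [hz hz']
  · intro ψ hψ hψc hψs
    rw [← setIntegral_eq_integral_of_forall_compl_eq_zero (s := Ioo (0 : ℝ) 1) fun x hx => by
      rw [image_eq_zero_of_notMem_tsupport fun h => hx (hψs h), zero_smul]]
    set m := ∫ z in Ioo (0 : ℝ) 1, ψ z with hm
    have iψ : IntegrableOn ψ (Ioo (0 : ℝ) 1) := (hψ.continuous.integrable_of_hasCompactSupport
      hψc).integrableOn
    have iχ : IntegrableOn χ (Ioo (0 : ℝ) 1) := (hχ.continuous.integrable_of_hasCompactSupport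
      hχc).integrableOn
    have hsub : tsupport (fun z => ψ z - m * χ z) ⊆ tsupport ψ ∪ tsupport χ := by
      refine closure_minimal (fun x hx => ?_)
        ((isClosed_tsupport ψ).union (isClosed_tsupport χ))
      by_contra hn
      rw [mem_union, not_or] at hn
      apply hx
      simp [image_eq_zero_of_notMem_tsupport hn.1, image_eq_zero_of_notMem_tsupport hn.2]
    obtain ⟨φ, hφ, hφc, hφs, hφd⟩ := exists_testFunction_deriv_eq
      (ψ := fun z => ψ z - m * χ z) (hψ.sub (contDiff_const.mul hχ))
      ((hψc.isCompact.union hχc.isCompact).of_isClosed_subset (isClosed_tsupport _) hsub)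
      (hsub.trans (union_subset hψs hχs))
      (by rw [integral_sub iψ (iχ.const_mul m), integral_const_mul, hχ1, ← hm]; ring)
    have h1 := H φ hφ hφc hφs
    rw [hφd] at h1
    have h2 : ∫ z in Ioo (0 : ℝ) 1, h z * (ψ z - m * χ z)
        = (∫ z in Ioo (0 : ℝ) 1, h z * ψ z) - m * c := by
      rw [hcdef, ← integral_const_mul, ← integral_sub
        (integrableOn_Ioo_mul_of_continuous hh hψ.continuous)
        ((integrableOn_Ioo_mul_of_continuous hh hχ.continuous).const_mul m)]
      exact integral_congr_ae (Filter.Eventually.of_forall fun z => by simp only; ring)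
    have h3 : ∫ z in Ioo (0 : ℝ) 1, ψ z • (h z - c)
        = (∫ z in Ioo (0 : ℝ) 1, h z * ψ z) - c * m := by
      rw [hm, ← integral_const_mul, ← integral_sub
        (integrableOn_Ioo_mul_of_continuous hh hψ.continuous) (iψ.const_mul c)]
      exact integral_congr_ae (Filter.Eventually.of_forall fun z => by
        simp only [smul_eq_mul]; ring)
    rw [h3]
    linarith

/-- Fundamental theorem of calculus for weak derivatives on `(0,1)`. -/
theorem IsWeakDeriv.ae_eq_const_add_integral {F G : ℝ → ℝ} (hF : IntegrableOn F (Ioo (0 : ℝ) 1))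
    (hG : IntegrableOn G (Ioo (0 : ℝ) 1)) (h : IsWeakDeriv 1 F G) :
    ∃ c : ℝ, ∀ᵐ z, z ∈ Ioo (0 : ℝ) 1 → F z = c + ∫ s in (0 : ℝ)..z, G s := by
  have hGi : IntervalIntegrable G volume 0 1 := by
    rw [intervalIntegrable_iff_integrableOn_Ioc_of_le zero_le_one,
      integrableOn_Ioc_iff_integrableOn_Ioo]
    exact hG
  have hac : AbsolutelyContinuousOnInterval (fun x => ∫ s in (0 : ℝ)..x, G s) 0 1 :=
    hGi.absolutelyContinuousOnInterval_intervalIntegral (by simp)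
  have hI : IntegrableOn (fun x => ∫ s in (0 : ℝ)..x, G s) (Ioo (0 : ℝ) 1) := by
    have := hac.continuousOn
    rw [uIcc_of_le zero_le_one] at this
    exact this.integrableOn_Icc.mono_set Ioo_subset_Icc_self
  have hcon : ∀ φ : ℝ → ℝ, ContDiff ℝ ∞ φ → HasCompactSupport φ → tsupport φ ⊆ Ioo (0 : ℝ) 1 →
      ∫ z in Ioo (0 : ℝ) 1, (F z - ∫ s in (0 : ℝ)..z, G s) * deriv φ z = 0 := by
    intro φ hφ hφc hφs
    have hφ' : Continuous (deriv φ) := hφ.continuous_deriv (by simp)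
    have e0 : φ 0 = 0 := image_eq_zero_of_notMem_tsupport fun h => lt_irrefl _ (hφs h).1
    have e1 : φ 1 = 0 := image_eq_zero_of_notMem_tsupport fun h => lt_irrefl _ (hφs h).2
    have hφac : AbsolutelyContinuousOnInterval φ 0 1 := by
      have := (hφ'.intervalIntegrable 0 1).absolutelyContinuousOnInterval_intervalIntegral
        (c := 0) (by simp)
      convert this using 1
      funext x
      rw [intervalIntegral.integral_deriv_eq_sub (fun y _ => (hφ.differentiable (by simp)) y)
        (hφ'.intervalIntegrable _ _), e0, sub_zero]
    have ibp := hac.integral_mul_deriv_eq_deriv_mul hφac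
    have hGd : ∫ x in (0 : ℝ)..1, deriv (fun x => ∫ s in (0 : ℝ)..x, G s) x * φ x
        = ∫ x in (0 : ℝ)..1, G x * φ x := by
      refine intervalIntegral.integral_congr_ae ?_
      filter_upwards [hGi.ae_hasDerivAt_integral] with x hx hx'
      rw [(hx (uIoc_subset_uIcc hx') 0 (by simp)).deriv]
    rw [e0, e1, hGd] at ibp
    have hw := h φ hφ hφc hφs
    simp only [iteratedDeriv_one, pow_one] at hw
    simp only [sub_mul]
    rw [integral_sub (integrableOn_Ioo_mul_of_continuous hF hφ')
      (integrableOn_Ioo_mul_of_continuous hI hφ'), hw]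
    simp only [intervalIntegral.integral_of_le zero_le_one, integral_Ioc_eq_integral_Ioo] at ibp
    rw [ibp]
    ring
  obtain ⟨c, hc⟩ := ae_eq_const_of_integral_mul_deriv_eq_zero (hF.sub hI) hcon
  refine ⟨c, ?_⟩
  filter_upwards [hc] with z hz hz'
  have h := hz hz'
  simp only [Pi.sub_apply] at h
  linarith

theorem IsWeakDeriv.of_succ {k : ℕ} {f g g' : ℝ → ℝ} (hg : IsWeakDeriv k f g)
    (hg' : IsWeakDeriv (k + 1) f g') : IsWeakDeriv 1 g g' := by
  intro φ hφ hφc hφs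
  have h1 := hg (deriv φ) (contDiff_infty_iff_deriv.1 hφ).2 hφc.deriv
    (tsupport_deriv_subset.trans hφs)
  have h2 := hg' φ hφ hφc hφs
  rw [iteratedDeriv_succ'] at h2
  rw [iteratedDeriv_one, pow_one]
  have h3 := h1.symm.trans h2
  rw [pow_succ, mul_assoc] at h3
  exact mul_left_cancel₀ (pow_ne_zero k (by norm_num)) h3

/-- Sobolev embedding `H³(0,1) ⊆ C²([0,1])`, with the `C²` function defined on all of `ℝ`. -/
theorem MemSobolevH.exists_contDiff_two_eqOn {f : ℝ → ℝ} (hf : MemSobolevH 3 f)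
    (hc : ContinuousOn f (Icc 0 1)) : ∃ F : ℝ → ℝ, ContDiff ℝ 2 F ∧ EqOn F f (Icc 0 1) := by
  have hint : ∀ {g : ℝ → ℝ}, MemLp g 2 (volume.restrict (Ioo (0 : ℝ) 1)) →
      IntegrableOn g (Ioo (0 : ℝ) 1) := fun hg => hg.integrable (by norm_num)
  obtain ⟨hf0, hfk⟩ := hf
  obtain ⟨g₁, hg₁, hw₁⟩ := hfk 1 le_rfl (by norm_num)
  obtain ⟨g₂, hg₂, hw₂⟩ := hfk 2 (by norm_num) (by norm_num)
  obtain ⟨g₃, hg₃, hw₃⟩ := hfk 3 (by norm_num) le_rfl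
  -- primitives over `[0,z]`, `0 < z < 1`, only see the almost everywhere class on `(0,1)`
  have hcongr : ∀ {g h : ℝ → ℝ}, (∀ᵐ z, z ∈ Ioo (0 : ℝ) 1 → g z = h z) → ∀ z ∈ Ioo (0 : ℝ) 1,
      ∫ s in (0 : ℝ)..z, g s = ∫ s in (0 : ℝ)..z, h s := fun hgh z hz => by
    refine intervalIntegral.integral_congr_ae ?_
    filter_upwards [hgh] with s hs hs'
    rw [uIoc_of_le hz.1.le] at hs'
    exact hs ⟨hs'.1, hs'.2.trans_lt hz.2⟩
  obtain ⟨c₂, hc₂⟩ := (hw₂.of_succ hw₃).ae_eq_const_add_integral (hint hg₂) (hint hg₃)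
  obtain ⟨c₁, hc₁⟩ := (hw₁.of_succ hw₂).ae_eq_const_add_integral (hint hg₁) (hint hg₂)
  obtain ⟨c₀, hc₀⟩ := hw₁.ae_eq_const_add_integral (hint hf0) (hint hg₁)
  set k₃ : ℝ → ℝ := (Ioo (0 : ℝ) 1).indicator g₃ with hk₃
  have hik₃ : Integrable k₃ := (integrable_indicator_iff measurableSet_Ioo).2 (hint hg₃)
  set f₂ : ℝ → ℝ := fun z => c₂ + ∫ s in (0 : ℝ)..z, k₃ s with hf₂
  have hf₂c : Continuous f₂ := continuous_const.add
    (intervalIntegral.continuous_primitive (fun _ _ => hik₃.intervalIntegrable) 0)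
  set f₁ : ℝ → ℝ := fun z => c₁ + ∫ s in (0 : ℝ)..z, f₂ s with hf₁
  have hf₁d : ∀ x, HasDerivAt f₁ (f₂ x) x := hasDerivAt_const_add_primitive hf₂c c₁
  have hf₁c : ContDiff ℝ ((1 : ℕ) : WithTop ℕ∞) f₁ :=
    contDiff_succ_of_hasDerivAt (n := 0) (contDiff_zero.2 hf₂c) hf₁d
  set F : ℝ → ℝ := fun z => c₀ + ∫ s in (0 : ℝ)..z, f₁ s with hF
  have hFc : ContDiff ℝ 2 F := by
    simpa using contDiff_succ_of_hasDerivAt hf₁c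
      (hasDerivAt_const_add_primitive hf₁c.continuous c₀)
  have e₂ : ∀ᵐ z, z ∈ Ioo (0 : ℝ) 1 → g₂ z = f₂ z := by
    filter_upwards [hc₂] with z hz hz'
    rw [hz hz', hf₂, hcongr (h := k₃) (Filter.Eventually.of_forall fun s hs => by
      rw [hk₃, indicator_of_mem hs]) z hz']
  have e₁ : ∀ᵐ z, z ∈ Ioo (0 : ℝ) 1 → g₁ z = f₁ z := by
    filter_upwards [hc₁] with z hz hz'
    rw [hz hz', hf₁, hcongr e₂ z hz']
  have e₀ : ∀ᵐ z, z ∈ Ioo (0 : ℝ) 1 → f z = F z := by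
    filter_upwards [hc₀] with z hz hz'
    rw [hz hz', hF, hcongr e₁ z hz']
  refine ⟨F, hFc, ?_⟩
  have h := Measure.eqOn_Icc_of_ae_eq (μ := volume) (f := F) (g := f) zero_ne_one
    (((ae_restrict_iff' measurableSet_Icc).2 ?_)) hFc.continuous.continuousOn hc
  · exact h
  · have h0 : ∀ᵐ z : ℝ, z ≠ 0 := Measure.ae_ne volume 0
    have h1 : ∀ᵐ z : ℝ, z ≠ 1 := Measure.ae_ne volume 1
    filter_upwards [e₀, h0, h1] with z hz hz0 hz1 hz'
    exact (hz ⟨lt_of_le_of_ne hz'.1 (Ne.symm hz0), lt_of_le_of_ne hz'.2 hz1⟩).symm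

/-! ### Absolutely convergent sine series -/

/-- The frequencies `(n + 1)π` of the Dirichlet eigenfunctions `sin((n + 1)πz)` on `[0,1]`. The shift
makes all of them positive, in fact at least `1`. -/
noncomputable def dirichletFreq (n : ℕ) : ℝ := (n + 1) * Real.pi

theorem one_le_dirichletFreq (n : ℕ) : 1 ≤ dirichletFreq n := by
  have h1 : (0 : ℝ) ≤ n := n.cast_nonneg
  have h2 := Real.pi_gt_three
  unfold dirichletFreq
  nlinarith

theorem dirichletFreq_pos (n : ℕ) : 0 < dirichletFreq n :=
  zero_lt_one.trans_le (one_le_dirichletFreq n)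

theorem summable_one_div_dirichletFreq_sq : Summable fun n => 1 / dirichletFreq n ^ 2 := by
  have h := (summable_nat_add_iff 1).2 (Real.summable_one_div_nat_pow.2 (by norm_num : 1 < 2))
  refine (h.mul_left (1 / Real.pi ^ 2)).congr fun n => ?_
  simp only [dirichletFreq]
  push_cast
  field_simp

theorem sin_dirichletFreq (n : ℕ) : Real.sin (dirichletFreq n) = 0 := by
  have := Real.sin_nat_mul_pi (n + 1)
  push_cast at this
  exact this

theorem hasSum_cos_dirichletFreq_div_sq {s : ℝ} (hs : s ∈ Icc (0 : ℝ) 2) :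
    HasSum (fun n => Real.cos (dirichletFreq n * s) / dirichletFreq n ^ 2)
      (s ^ 2 / 4 - s / 2 + 1 / 6) := by
  have hx : s / 2 ∈ Icc (0 : ℝ) 1 := ⟨by linarith [hs.1], by linarith [hs.2]⟩
  have h := hasSum_one_div_nat_pow_mul_cos one_ne_zero hx
  rw [← hasSum_nat_add_iff' 1] at h
  have hb : (Polynomial.map (algebraMap ℚ ℝ) (Polynomial.bernoulli (2 * 1))).eval (s / 2)
      = (s / 2) ^ 2 - s / 2 + 1 / 6 := by
    simp [Polynomial.bernoulli, Finset.sum_range_succ, bernoulli_one, bernoulli_two]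
    ring
  rw [hb] at h
  have h' := h.mul_left (1 / Real.pi ^ 2)
  have hpi := Real.pi_ne_zero
  convert! h' using 1
  · funext n
    simp only [dirichletFreq]
    push_cast
    rw [show 2 * Real.pi * ((n : ℝ) + 1) * (s / 2) = ((n : ℝ) + 1) * Real.pi * s by ring]
    field_simp
  · simp
    field_simp
    ring

/-- The sine expansion of Green's function of `-d²/dz²` on `[0,1]` with Dirichlet conditions. -/
theorem hasSum_dirichlet_green {z w : ℝ} (hz : z ∈ Icc (0 : ℝ) 1) (hw : w ∈ Icc (0 : ℝ) 1) :
    HasSum (fun n => 2 / dirichletFreq n ^ 2 * Real.sin (dirichletFreq n * z)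
      * Real.sin (dirichletFreq n * w)) (min z w - z * w) := by
  have h1 := hasSum_cos_dirichletFreq_div_sq (s := |z - w|) ⟨abs_nonneg _, by
    rw [abs_le]; constructor <;> linarith [hz.1, hz.2, hw.1, hw.2]⟩
  have h2 := hasSum_cos_dirichletFreq_div_sq (s := z + w)
    ⟨by linarith [hz.1, hw.1], by linarith [hz.2, hw.2]⟩
  convert! h1.sub h2 using 1
  · funext n
    have : Real.cos (dirichletFreq n * |z - w|) = Real.cos (dirichletFreq n * (z - w)) := by
      rw [← Real.cos_abs (dirichletFreq n * (z - w)), abs_mul,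
        abs_of_pos (dirichletFreq_pos n)]
    rw [this, mul_sub, mul_add, Real.cos_sub, Real.cos_add]
    have := (dirichletFreq_pos n).ne'
    field_simp
    ring
  · rw [sq_abs]
    rcases le_total z w with h | h
    · rw [min_eq_left h, abs_of_nonpos (by linarith)]; ring
    · rw [min_eq_right h, abs_of_nonneg (by linarith)]; ring

theorem hasDerivAt_of_contDiff_two {f : ℝ → ℝ} (hf : ContDiff ℝ 2 f) :
    Continuous (deriv f) ∧ Continuous (iteratedDeriv 2 f) ∧ (∀ x, HasDerivAt f (deriv f x) x) ∧
      ∀ x, HasDerivAt (deriv f) (iteratedDeriv 2 f x) x := by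
  have h := hf
  rw [show (2 : WithTop ℕ∞) = 1 + 1 by norm_num, contDiff_succ_iff_deriv] at h
  obtain ⟨h1, -, h2⟩ := h
  refine ⟨h2.continuous, hf.continuous_iteratedDeriv 2 le_rfl, fun x => (h1 x).hasDerivAt,
    fun x => ?_⟩
  rw [iteratedDeriv_succ, iteratedDeriv_one]
  exact ((h2.differentiable one_ne_zero) x).hasDerivAt

/-- Green's representation formula on `[0,1]` with Dirichlet conditions. -/
theorem integral_dirichlet_green {f : ℝ → ℝ} (hf : ContDiff ℝ 2 f) (h0 : f 0 = 0) (h1 : f 1 = 0)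
    {z : ℝ} (hz : z ∈ Icc (0 : ℝ) 1) :
    ∫ w in (0 : ℝ)..1, (min z w - z * w) * iteratedDeriv 2 f w = -f z := by
  obtain ⟨hc1, hc2, hd1, hd2⟩ := hasDerivAt_of_contDiff_two hf
  have hc : Continuous fun w => (min z w - z * w) * iteratedDeriv 2 f w := by fun_prop
  have hl : ∫ w in (0 : ℝ)..z, (min z w - z * w) * iteratedDeriv 2 f w
      = (1 - z) * (z * deriv f z - f z) := by
    rw [intervalIntegral.integral_congr
      (g := fun w => (1 - z) * (w * iteratedDeriv 2 f w)) fun w hw => ?_]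
    · rw [intervalIntegral.integral_eq_sub_of_hasDerivAt
        (f := fun w => (1 - z) * (w * deriv f w - f w)) (fun w _ => ?_)
        (Continuous.intervalIntegrable (by fun_prop) _ _)]
      · simp [h0]
      · convert! (((hasDerivAt_id' w).fun_mul (hd2 w)).fun_sub (hd1 w)).const_mul (1 - z) using 1
        ring
    · rw [uIcc_of_le hz.1] at hw
      simp only [min_eq_right hw.2]
      ring
  have hr : ∫ w in z..1, (min z w - z * w) * iteratedDeriv 2 f w
      = -(z * ((1 - z) * deriv f z + f z)) := by
    rw [intervalIntegral.integral_congr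
      (g := fun w => z * ((1 - w) * iteratedDeriv 2 f w)) fun w hw => ?_]
    · rw [intervalIntegral.integral_eq_sub_of_hasDerivAt
        (f := fun w => z * ((1 - w) * deriv f w + f w)) (fun w _ => ?_)
        (Continuous.intervalIntegrable (by fun_prop) _ _)]
      · simp [h1]
      · convert! (((((hasDerivAt_id' w).const_sub 1).fun_mul (hd2 w)).fun_add
          (hd1 w)).const_mul z) using 1
        ring
    · rw [uIcc_of_le hz.2] at hw
      simp only [min_eq_left hw.1]
      ring
  rw [← intervalIntegral.integral_add_adjacent_intervals (hc.intervalIntegrable 0 z)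
    (hc.intervalIntegrable z 1), hl, hr]
  ring

/-- A `C²` function vanishing at `0` and `1` is the sum on `[0,1]` of an absolutely convergent
sine series: insert the expansion of Green's function in the representation formula. -/
theorem exists_hasSum_sine_series {f : ℝ → ℝ} (hf : ContDiff ℝ 2 f) (h0 : f 0 = 0)
    (h1 : f 1 = 0) : ∃ c : ℕ → ℝ, Summable (fun n => |c n|) ∧
      ∀ z ∈ Icc (0 : ℝ) 1, HasSum (fun n => c n * Real.sin (dirichletFreq n * z)) (f z) := by
  have hc2 : Continuous (iteratedDeriv 2 f) := hf.continuous_iteratedDeriv 2 le_rfl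
  obtain ⟨M, hM⟩ := (isCompact_Icc (a := (0 : ℝ)) (b := 1)).exists_bound_of_continuousOn
    hc2.continuousOn
  have hM' : ∀ w ∈ uIoc (0 : ℝ) 1, |iteratedDeriv 2 f w| ≤ M := fun w hw => by
    rw [uIoc_of_le zero_le_one] at hw
    exact hM w ⟨hw.1.le, hw.2⟩
  set c : ℕ → ℝ := fun n => -(2 / dirichletFreq n ^ 2 *
    ∫ w in (0 : ℝ)..1, Real.sin (dirichletFreq n * w) * iteratedDeriv 2 f w) with hc
  refine ⟨c, ?_, fun z hz => ?_⟩
  · refine Summable.of_nonneg_of_le (fun n => abs_nonneg _) (fun n => ?_)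
      (summable_one_div_dirichletFreq_sq.mul_left (2 * M))
    have hb : |∫ w in (0 : ℝ)..1, Real.sin (dirichletFreq n * w) * iteratedDeriv 2 f w| ≤ M := by
      have := intervalIntegral.norm_integral_le_of_norm_le_const (a := 0) (b := 1) (C := M)
        (f := fun w => Real.sin (dirichletFreq n * w) * iteratedDeriv 2 f w) fun w hw => by
          rw [norm_mul, Real.norm_eq_abs, Real.norm_eq_abs]
          calc |Real.sin (dirichletFreq n * w)| * |iteratedDeriv 2 f w|
              ≤ 1 * |iteratedDeriv 2 f w| :=
                mul_le_mul_of_nonneg_right (Real.abs_sin_le_one _) (abs_nonneg _)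
            _ ≤ M := by rw [one_mul]; exact hM' w hw
      simpa using this
    have hp : 0 ≤ 2 / dirichletFreq n ^ 2 := by positivity
    rw [hc, abs_neg, abs_mul, abs_of_nonneg hp]
    calc _ ≤ 2 / dirichletFreq n ^ 2 * M := mul_le_mul_of_nonneg_left hb hp
      _ = _ := by ring
  · have key := intervalIntegral.hasSum_integral_of_dominated_convergence (μ := volume) (a := 0)
      (b := 1)
      (F := fun n w => 2 / dirichletFreq n ^ 2 * Real.sin (dirichletFreq n * z)
        * Real.sin (dirichletFreq n * w) * iteratedDeriv 2 f w)
      (f := fun w => (min z w - z * w) * iteratedDeriv 2 f w)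
      (fun n _ => 2 * M * (1 / dirichletFreq n ^ 2))
      (fun n => Continuous.aestronglyMeasurable (by fun_prop))
      (fun n => Filter.Eventually.of_forall fun w hw => ?_)
      (Filter.Eventually.of_forall fun w _ => summable_one_div_dirichletFreq_sq.mul_left _)
      intervalIntegrable_const
      (Filter.Eventually.of_forall fun w hw => ?_)
    · rw [integral_dirichlet_green hf h0 h1 hz] at key
      convert! key.neg using 1
      · funext n
        simp only [mul_assoc, intervalIntegral.integral_const_mul, hc]
        ring
      · ring
    · have hp : 0 ≤ 2 / dirichletFreq n ^ 2 := by positivity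
      rw [Real.norm_eq_abs, abs_mul, abs_mul, abs_mul, abs_of_nonneg hp]
      have a1 := Real.abs_sin_le_one (dirichletFreq n * z)
      have a2 := Real.abs_sin_le_one (dirichletFreq n * w)
      have a3 := hM' w hw
      calc 2 / dirichletFreq n ^ 2 * |Real.sin (dirichletFreq n * z)|
            * |Real.sin (dirichletFreq n * w)| * |iteratedDeriv 2 f w|
          ≤ 2 / dirichletFreq n ^ 2 * 1 * 1 * M := by gcongr
        _ = _ := by ring
    · rw [uIoc_of_le zero_le_one] at hw
      exact (hasSum_dirichlet_green hz ⟨hw.1.le, hw.2⟩).mul_right _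

/-! ### Fourier modes: existence and uniform estimates -/

/-- Variation of constants for `Y' = A Y + f`. -/
theorem exists_hasDerivAt_linear_inhomogeneous {E : Type*} [NormedAddCommGroup E]
    [NormedSpace ℝ E] [CompleteSpace E] (A : E →L[ℝ] E) {f : ℝ → E} (hf : Continuous f) (Y₀ : E) :
    ∃ Y : ℝ → E, Y 0 = Y₀ ∧ ∀ t, HasDerivAt Y (A (Y t) + f t) t := by
  let : NormedAlgebra ℚ (E →L[ℝ] E) := NormedAlgebra.restrictScalars ℚ ℝ (E →L[ℝ] E)
  have hexp : ∀ t : ℝ, HasDerivAt (fun u : ℝ => NormedSpace.exp (u • A))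
      (A * NormedSpace.exp (t • A)) t := fun t => hasDerivAt_exp_smul_const' A t
  have hcont : Continuous fun u : ℝ => NormedSpace.exp (u • A) :=
    continuous_iff_continuousAt.2 fun t => (hexp t).continuousAt
  have hinv : ∀ t : ℝ, ∀ x : E, NormedSpace.exp (t • A) (NormedSpace.exp ((-t) • A) x) = x := by
    intro t x
    rw [← mul_apply_eq_comp, ← NormedSpace.exp_add_of_commute
      ((Commute.refl A).smul_left t |>.smul_right (-t)), ← add_smul]
    simp
  have hg : Continuous fun s : ℝ => NormedSpace.exp ((-s) • A) (f s) :=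
    (hcont.comp continuous_neg).clm_apply hf
  have hW : ∀ t, HasDerivAt (fun t => Y₀ + ∫ s in (0 : ℝ)..t, NormedSpace.exp ((-s) • A) (f s))
      (NormedSpace.exp ((-t) • A) (f t)) t := fun t =>
    (intervalIntegral.integral_hasDerivAt_right (hg.intervalIntegrable _ _)
      (hg.stronglyMeasurableAtFilter _ _) hg.continuousAt).const_add Y₀
  refine ⟨fun t => NormedSpace.exp (t • A)
    (Y₀ + ∫ s in (0 : ℝ)..t, NormedSpace.exp ((-s) • A) (f s)), by simp, fun t => ?_⟩
  have h := (hexp t).clm_apply (hW t)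
  rw [hinv t (f t)] at h
  exact h

/-- The amplitudes `y`, `v` of a Fourier mode solve a linear `2 × 2` system. -/
theorem exists_mode (l K κ b y₀ : ℝ) {s : ℝ → ℝ} (hs : Continuous s) :
    ∃ y v : ℝ → ℝ, y 0 = y₀ ∧ v 0 = 0 ∧
      (∀ t, HasDerivAt y (-(l + K) * y t + κ * v t + s t) t) ∧
      ∀ t, HasDerivAt v (y t - b * v t) t := by
  let A : ℝ × ℝ →L[ℝ] ℝ × ℝ :=
    ((-(l + K)) • ContinuousLinearMap.fst ℝ ℝ ℝ + κ • ContinuousLinearMap.snd ℝ ℝ ℝ).prod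
      (ContinuousLinearMap.fst ℝ ℝ ℝ - b • ContinuousLinearMap.snd ℝ ℝ ℝ)
  obtain ⟨Y, hY0, hY⟩ := exists_hasDerivAt_linear_inhomogeneous A
    (f := fun t => (s t, (0 : ℝ))) (by fun_prop) (y₀, 0)
  refine ⟨fun t => (Y t).1, fun t => (Y t).2, by simp [hY0], by simp [hY0], fun t => ?_, fun t => ?_⟩
  · simpa [A] using (hY t).hasFDerivAt.fst.hasDerivAt
  · simpa [A] using (hY t).hasFDerivAt.snd.hasDerivAt

/-- Grönwall's inequality `E' ≤ M E`, stated as monotonicity so that `E` need only be differentiable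
in the interior. -/
theorem antitoneOn_exp_mul_of_deriv_le {E E' : ℝ → ℝ} {M T : ℝ}
    (hc : ContinuousOn E (Icc 0 T)) (hE : ∀ t ∈ Ioo 0 T, HasDerivAt E (E' t) t)
    (hle : ∀ t ∈ Ioo 0 T, E' t ≤ M * E t) :
    AntitoneOn (fun t => Real.exp (-M * t) * E t) (Icc 0 T) := by
  have hexp : ∀ t, HasDerivAt (fun t => Real.exp (-M * t)) (Real.exp (-M * t) * -M) t := fun t =>
    (by simpa using (hasDerivAt_id' t).const_mul (-M) : HasDerivAt (fun t => -M * t) (-M) t).exp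
  refine antitoneOn_of_deriv_nonpos (convex_Icc 0 T)
    ((Real.continuous_exp.comp (continuous_const.mul continuous_id)).continuousOn.mul hc) ?_ ?_
  · rw [interior_Icc]
    intro t ht
    exact ((hexp t).fun_mul (hE t ht)).differentiableAt.differentiableWithinAt
  · rw [interior_Icc]
    intro t ht
    rw [((hexp t).fun_mul (hE t ht)).deriv]
    have := mul_le_mul_of_nonneg_left (hle t ht) (Real.exp_pos (-M * t)).le
    linarith

/-- Energy estimate for a mode with eigenvalue `l = w²`: with `E = y² + w² v²` the terms
`2 w² v y` arising from `v' = y - b v` are absorbed by the dissipation `-2 w² y²`. -/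
theorem mode_energy_bound {w K κ b T σ y₀ : ℝ} (hw : 1 ≤ w) {s y v : ℝ → ℝ} (hy0 : y 0 = y₀)
    (hv0 : v 0 = 0) (hy : ∀ t, HasDerivAt y (-(w ^ 2 + K) * y t + κ * v t + s t) t)
    (hv : ∀ t, HasDerivAt v (y t - b * v t) t) (hσ : ∀ t ∈ Icc 0 T, |s t| ≤ σ) :
    ∀ t ∈ Icc 0 T, |y t| ≤ Real.exp ((2 * |K| + |κ| + 2 + 2 * |b|) * T) * (|y₀| + σ) ∧
      w * |v t| ≤ Real.exp ((2 * |K| + |κ| + 2 + 2 * |b|) * T) * (|y₀| + σ) := by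
  intro t ht
  set M := 2 * |K| + |κ| + 2 + 2 * |b| with hM
  have hT : 0 ≤ T := ht.1.trans ht.2
  have hσ0 : 0 ≤ σ := (abs_nonneg _).trans (hσ t ht)
  have hM1 : 1 ≤ M := by
    have := abs_nonneg K; have := abs_nonneg κ; have := abs_nonneg b; linarith
  -- the constant `σ²` turns `E' ≤ M E + σ²` into a homogeneous inequality
  set E : ℝ → ℝ := fun t => y t ^ 2 + w ^ 2 * v t ^ 2 + σ ^ 2 with hE
  have hd : ∀ t, HasDerivAt E (2 * y t * (-(w ^ 2 + K) * y t + κ * v t + s t)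
      + w ^ 2 * (2 * v t * (y t - b * v t))) t := fun t => by
    have h1 := ((hy t).fun_pow 2).fun_add (((hv t).fun_pow 2).const_mul (w ^ 2)) |>.add_const
      (σ ^ 2)
    convert! h1 using 1
    push_cast
    ring
  have hanti := antitoneOn_exp_mul_of_deriv_le (M := M) (T := T)
    (continuous_iff_continuousAt.2 fun t => (hd t).continuousAt).continuousOn
    (fun t _ => hd t) (fun t ht => ?_)
  · have h0 := hanti (left_mem_Icc.2 hT) ht ht.1
    simp only [mul_zero, Real.exp_zero, one_mul, hE, hy0, hv0] at h0
    have hEt : y t ^ 2 + w ^ 2 * v t ^ 2 + σ ^ 2 ≤ Real.exp (M * T) * (y₀ ^ 2 + σ ^ 2) := by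
      have h1 := mul_le_mul_of_nonneg_left h0 (Real.exp_pos (M * t)).le
      rw [← mul_assoc, ← Real.exp_add] at h1
      have h2 : Real.exp (M * t) ≤ Real.exp (M * T) :=
        Real.exp_le_exp.2 (mul_le_mul_of_nonneg_left ht.2 (by linarith))
      have h3 := mul_le_mul_of_nonneg_right h2 (by positivity : 0 ≤ y₀ ^ 2 + σ ^ 2)
      have h4 : Real.exp (M * t + -M * t) = 1 := by simp
      rw [h4] at h1
      linarith
    -- the square root of `e^{MT}` is bounded by `e^{MT}` itself
    have hX : Real.exp (M * T) * (y₀ ^ 2 + σ ^ 2) ≤ (Real.exp (M * T) * (|y₀| + σ)) ^ 2 := by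
      have hx : 1 ≤ Real.exp (M * T) := Real.one_le_exp (by positivity)
      have h1 : y₀ ^ 2 + σ ^ 2 ≤ (|y₀| + σ) ^ 2 := by
        rw [← sq_abs y₀]
        nlinarith [mul_nonneg (abs_nonneg y₀) hσ0]
      rw [mul_pow]
      calc Real.exp (M * T) * (y₀ ^ 2 + σ ^ 2) ≤ Real.exp (M * T) ^ 2 * (y₀ ^ 2 + σ ^ 2) :=
            mul_le_mul_of_nonneg_right (by nlinarith) (by positivity)
        _ ≤ _ := mul_le_mul_of_nonneg_left h1 (by positivity)
    have hpos : 0 ≤ Real.exp (M * T) * (|y₀| + σ) := by positivity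
    have := sq_nonneg (y t)
    have := sq_nonneg σ
    have : 0 ≤ w ^ 2 * v t ^ 2 := by positivity
    refine ⟨abs_le_of_sq_le_sq (by linarith) hpos, ?_⟩
    rw [← abs_of_pos (zero_lt_one.trans_le hw), ← abs_mul]
    refine abs_le_of_sq_le_sq ?_ hpos
    rw [mul_pow]
    linarith
  · have hs' : s t ^ 2 ≤ σ ^ 2 := by
      rw [← sq_abs (s t)]
      exact pow_le_pow_left₀ (abs_nonneg _) (hσ t (Ioo_subset_Icc_self ht)) 2
    have hw2 : 1 ≤ w ^ 2 := by nlinarith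
    have k1 : -2 * K * y t ^ 2 ≤ 2 * |K| * y t ^ 2 := by
      nlinarith [neg_abs_le K, sq_nonneg (y t)]
    have k2 : 2 * κ * (y t * v t) ≤ |κ| * (y t ^ 2 + v t ^ 2) := by
      have h1 : κ * (2 * (y t * v t)) ≤ |κ| * |2 * (y t * v t)| := by
        rw [← abs_mul]; exact le_abs_self _
      have h2 : |2 * (y t * v t)| ≤ y t ^ 2 + v t ^ 2 := by
        rw [abs_le]; constructor <;> nlinarith [sq_nonneg (y t + v t), sq_nonneg (y t - v t)]
      nlinarith [mul_le_mul_of_nonneg_left h2 (abs_nonneg κ)]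
    have k3 : 2 * (y t * s t) ≤ y t ^ 2 + σ ^ 2 := by nlinarith [sq_nonneg (y t - s t)]
    have k4 : w ^ 2 * (2 * (v t * y t)) ≤ w ^ 2 * (y t ^ 2 + v t ^ 2) :=
      mul_le_mul_of_nonneg_left (by nlinarith [sq_nonneg (y t - v t)]) (by positivity)
    have k5 : -2 * b * (w ^ 2 * v t ^ 2) ≤ 2 * |b| * (w ^ 2 * v t ^ 2) := by
      have : 0 ≤ w ^ 2 * v t ^ 2 := by positivity
      nlinarith [neg_abs_le b]
    have k6 : v t ^ 2 ≤ w ^ 2 * v t ^ 2 := le_mul_of_one_le_left (sq_nonneg _) hw2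
    have k7 : |κ| * v t ^ 2 ≤ |κ| * (w ^ 2 * v t ^ 2) :=
      mul_le_mul_of_nonneg_left k6 (abs_nonneg κ)
    have k8 : 0 ≤ w ^ 2 * y t ^ 2 := by positivity
    have k9 : 0 ≤ w ^ 2 * v t ^ 2 := by positivity
    have p1 : 0 ≤ |b| * y t ^ 2 := by positivity
    have p2 : 0 ≤ |K| * (w ^ 2 * v t ^ 2) := by positivity
    have p3 : 0 ≤ (M - 1) * σ ^ 2 := mul_nonneg (by linarith) (sq_nonneg _)
    have p4 := sq_nonneg (y t)
    simp only [hE]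
    have e : M * (y t ^ 2 + w ^ 2 * v t ^ 2 + σ ^ 2) = M * y t ^ 2 + M * (w ^ 2 * v t ^ 2)
      + ((M - 1) * σ ^ 2 + σ ^ 2) := by ring
    rw [e, hM]
    rw [hM] at p3
    nlinarith

/-- Decay of solutions of `y' = -l y + h`, by comparison with the equilibrium `η / l`. -/
theorem abs_le_of_hasDerivAt_relaxation {l T η : ℝ} (hl : 0 < l) {y h : ℝ → ℝ}
    (hy : ∀ t, HasDerivAt y (-l * y t + h t) t) (hη : ∀ t ∈ Icc 0 T, |h t| ≤ η) :
    ∀ t ∈ Icc 0 T, |y t| ≤ Real.exp (-l * t) * |y 0| + η / l := by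
  have key : ∀ {y h : ℝ → ℝ}, (∀ t, HasDerivAt y (-l * y t + h t) t) →
      (∀ t ∈ Icc 0 T, h t ≤ η) → 0 ≤ η →
      ∀ t ∈ Icc 0 T, y t ≤ Real.exp (-l * t) * |y 0| + η / l := by
    intro y h hy hη hη0 t ht
    have hc : Continuous y := continuous_iff_continuousAt.2 fun t => (hy t).continuousAt
    have hanti := antitoneOn_exp_mul_of_deriv_le (M := -l) (T := T) (E := fun t => y t - η / l)
      (hc.sub continuous_const).continuousOn (fun t _ => (hy t).sub_const _) (fun t ht => by
        have : l * (η / l) = η := mul_div_cancel₀ _ hl.ne'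
        have := hη t (Ioo_subset_Icc_self ht)
        nlinarith)
    have h0 := hanti (left_mem_Icc.2 (ht.1.trans ht.2)) ht ht.1
    simp only [neg_neg, mul_zero, Real.exp_zero, one_mul] at h0
    have h1 := mul_le_mul_of_nonneg_left h0 (Real.exp_pos (-l * t)).le
    rw [← mul_assoc, ← Real.exp_add] at h1
    have h4 : Real.exp (-l * t + l * t) = 1 := by simp
    rw [h4, one_mul] at h1
    have h5 : Real.exp (-l * t) * (y 0 - η / l) ≤ Real.exp (-l * t) * |y 0| :=
      mul_le_mul_of_nonneg_left (by
        have := le_abs_self (y 0)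
        have : 0 ≤ η / l := by positivity
        linarith) (Real.exp_pos _).le
    linarith
  intro t ht
  have hη0 : 0 ≤ η := (abs_nonneg _).trans (hη t ht)
  rw [abs_le']
  refine ⟨key hy (fun t ht => (le_abs_self _).trans (hη t ht)) hη0 t ht, ?_⟩
  have := key (y := fun t => -y t) (h := fun t => -h t) (fun t => by
    convert! (hy t).fun_neg using 1
    ring) (fun t ht => (neg_le_abs _).trans (hη t ht)) hη0 t ht
  simpa using this

/-- Parabolic smoothing for a mode: for `t ≥ ε` two powers of the frequency are gained. -/
theorem mode_smoothing_bound {w K κ b T σ y₀ ε : ℝ} (hw : 1 ≤ w) (hε : 0 < ε) {s y v : ℝ → ℝ}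
    (hy0 : y 0 = y₀) (hv0 : v 0 = 0)
    (hy : ∀ t, HasDerivAt y (-(w ^ 2 + K) * y t + κ * v t + s t) t)
    (hv : ∀ t, HasDerivAt v (y t - b * v t) t) (hσ : ∀ t ∈ Icc 0 T, |s t| ≤ σ) :
    ∀ t ∈ Icc ε T, w ^ 2 * |y t| ≤
      (1 / ε + (|K| + |κ|) * Real.exp ((2 * |K| + |κ| + 2 + 2 * |b|) * T) + 1) * (|y₀| + σ) := by
  intro t ht
  have ht' : t ∈ Icc 0 T := ⟨hε.le.trans ht.1, ht.2⟩
  have hσ0 : 0 ≤ σ := (abs_nonneg _).trans (hσ t ht')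
  have hB := mode_energy_bound hw hy0 hv0 hy hv hσ
  set C := Real.exp ((2 * |K| + |κ| + 2 + 2 * |b|) * T) with hC
  have hC0 : 0 < C := Real.exp_pos _
  have hw2 : 0 < w ^ 2 := by positivity
  -- `K y` is treated as part of the forcing, so that the decay rate `w²` is positive for every mode
  have h := abs_le_of_hasDerivAt_relaxation (l := w ^ 2) (T := T)
    (h := fun t => -K * y t + κ * v t + s t) (η := (|K| + |κ|) * (C * (|y₀| + σ)) + σ) hw2
    (fun t => by convert! hy t using 1; ring) (fun t ht => by
      obtain ⟨h1, h2⟩ := hB t ht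
      have h3 : |v t| ≤ C * (|y₀| + σ) := (le_mul_of_one_le_left (abs_nonneg _) hw).trans h2
      calc |-K * y t + κ * v t + s t| ≤ |K| * |y t| + |κ| * |v t| + |s t| := by
            refine (abs_add_three _ _ _).trans ?_
            rw [abs_mul, abs_mul, abs_neg]
        _ ≤ |K| * (C * (|y₀| + σ)) + |κ| * (C * (|y₀| + σ)) + σ := by
            gcongr
            exact hσ t ht
        _ = _ := by ring) t ht'
  rw [hy0] at h
  have hexp : w ^ 2 * Real.exp (-w ^ 2 * t) ≤ 1 / ε := by
    have h1 : w ^ 2 * t ≤ Real.exp (w ^ 2 * t) := by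
      have := Real.add_one_le_exp (w ^ 2 * t); linarith
    have h2 : w ^ 2 * ε ≤ Real.exp (w ^ 2 * t) :=
      (mul_le_mul_of_nonneg_left ht.1 hw2.le).trans h1
    rw [neg_mul, Real.exp_neg, le_div_iff₀ hε, mul_right_comm, ← div_eq_mul_inv]
    exact (div_le_one (Real.exp_pos _)).2 h2
  have h1 := mul_le_mul_of_nonneg_left h hw2.le
  have h2 := mul_le_mul_of_nonneg_right hexp (abs_nonneg y₀)
  have h3 : w ^ 2 * (((|K| + |κ|) * (C * (|y₀| + σ)) + σ) / w ^ 2)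
      = (|K| + |κ|) * (C * (|y₀| + σ)) + σ := mul_div_cancel₀ _ hw2.ne'
  have h4 : 0 ≤ 1 / ε * σ := by positivity
  have h5 := abs_nonneg y₀
  rw [mul_add, h3, ← mul_assoc] at h1
  linarith

/-! ### Regularity of sine series with time-dependent coefficients -/

/-- A function on an open set of the plane with continuous partial derivatives is `C¹`. -/
theorem contDiffOn_one_of_partial {f f₁ f₂ : ℝ → ℝ → ℝ} {S : Set (ℝ × ℝ)} (hS : IsOpen S)
    (h₁ : ∀ p ∈ S, HasDerivAt (fun t => f t p.2) (f₁ p.1 p.2) p.1)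
    (h₂ : ∀ p ∈ S, HasDerivAt (fun z => f p.1 z) (f₂ p.1 p.2) p.2)
    (hc₁ : ContinuousOn (fun p : ℝ × ℝ => f₁ p.1 p.2) S)
    (hc₂ : ContinuousOn (fun p : ℝ × ℝ => f₂ p.1 p.2) S) :
    ContDiffOn ℝ 1 (fun p : ℝ × ℝ => f p.1 p.2) S := by
  have hL : ∀ g : ℝ → ℝ → ℝ, ContinuousOn (fun p : ℝ × ℝ => g p.1 p.2) S → ContinuousOn
      (fun p : ℝ × ℝ => g p.1 p.2 • ContinuousLinearMap.id ℝ ℝ) S := fun g hg =>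
    hg.smul continuousOn_const
  have hfd : ∀ p ∈ S, HasFDerivAt (fun p : ℝ × ℝ => f p.1 p.2)
      (f₁ p.1 p.2 • ContinuousLinearMap.fst ℝ ℝ ℝ + f₂ p.1 p.2 • ContinuousLinearMap.snd ℝ ℝ ℝ)
      p := by
    intro p hp
    have hmem : ∀ᶠ v in nhds p, v ∈ S := hS.mem_nhds hp
    have h := hasStrictFDerivAt_uncurry_coprod (𝕜 := ℝ) (u := p) (f := f)
      (f₁ := fun t z => f₁ t z • ContinuousLinearMap.id ℝ ℝ)
      (f₂ := fun t z => f₂ t z • ContinuousLinearMap.id ℝ ℝ)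
      (hmem.mono fun v hv => by
        convert! (h₁ v hv).hasFDerivAt using 1
        ext; simp [Function.HasUncurry.uncurry])
      (hmem.mono fun v hv => by
        convert! (h₂ v hv).hasFDerivAt using 1
        ext; simp [Function.HasUncurry.uncurry])
      ((hL f₁ hc₁).continuousAt (hS.mem_nhds hp)) ((hL f₂ hc₂).continuousAt (hS.mem_nhds hp))
    convert! h.hasFDerivAt using 1
  rw [show (1 : WithTop ℕ∞) = 0 + 1 by norm_num, contDiffOn_succ_iff_fderiv_of_isOpen hS]
  refine ⟨fun p hp => (hfd p hp).differentiableAt.differentiableWithinAt, by simp, ?_⟩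
  rw [contDiffOn_zero]
  refine ContinuousOn.congr ?_ fun p hp => (hfd p hp).fderiv
  exact (hc₁.smul continuousOn_const).add (hc₂.smul continuousOn_const)

theorem abs_mul_sin_le (c x : ℝ) : |c * Real.sin x| ≤ |c| := by
  rw [abs_mul]
  exact mul_le_of_le_one_right (abs_nonneg _) (Real.abs_sin_le_one x)

theorem abs_mul_cos_le (c x : ℝ) : |c * Real.cos x| ≤ |c| := by
  rw [abs_mul]
  exact mul_le_of_le_one_right (abs_nonneg _) (Real.abs_cos_le_one x)

theorem hasDerivAt_mul_sin (c w z : ℝ) :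
    HasDerivAt (fun z => c * Real.sin (w * z)) (w * c * Real.cos (w * z)) z := by
  have h := (((hasDerivAt_id' z).const_mul w).sin).const_mul c
  convert! h using 1
  ring

theorem hasDerivAt_mul_cos (c w z : ℝ) :
    HasDerivAt (fun z => c * Real.cos (w * z)) (-(w * c) * Real.sin (w * z)) z := by
  have h := (((hasDerivAt_id' z).const_mul w).cos).const_mul c
  convert! h using 1
  ring

/-- The sum of the sine series with coefficients `A`. -/
noncomputable def sineSum (A : ℕ → ℝ) (z : ℝ) : ℝ := ∑' n, A n * Real.sin (dirichletFreq n * z)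

theorem summable_sine {A B : ℕ → ℝ} (hB : Summable B) (hA : ∀ n, |A n| ≤ B n) (z : ℝ) :
    Summable fun n => A n * Real.sin (dirichletFreq n * z) :=
  hB.of_norm_bounded fun n => (abs_mul_sin_le _ _).trans (hA n)

theorem sineSum_zero (A : ℕ → ℝ) : sineSum A 0 = 0 := by simp [sineSum]

theorem sineSum_one (A : ℕ → ℝ) : sineSum A 1 = 0 := by simp [sineSum, sin_dirichletFreq]

theorem continuousOn_sineSum {A : ℕ → ℝ → ℝ} {B : ℕ → ℝ} {I : Set ℝ} (hB : Summable B)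
    (hc : ∀ n, ContinuousOn (A n) I) (hA : ∀ n, ∀ t ∈ I, |A n t| ≤ B n) :
    ContinuousOn (fun p : ℝ × ℝ => sineSum (fun n => A n p.1) p.2) (I ×ˢ univ) := by
  refine continuousOn_tsum (fun n => ?_) hB fun n p hp =>
    (abs_mul_sin_le _ _).trans (hA n p.1 hp.1)
  exact ((hc n).comp continuousOn_fst fun p hp => hp.1).mul
    (Continuous.continuousOn (by fun_prop))

theorem sineSum_hasDerivAt_time {A A' : ℕ → ℝ → ℝ} {B : ℕ → ℝ} {I : Set ℝ} (hI : IsOpen I)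
    (hI' : I.OrdConnected) (hB : Summable B) (hA : ∀ n, ∀ t ∈ I, HasDerivAt (A n) (A' n t) t)
    (hb : ∀ n, ∀ t ∈ I, |A n t| ≤ B n) (hb' : ∀ n, ∀ t ∈ I, |A' n t| ≤ B n)
    {t : ℝ} (ht : t ∈ I) (z : ℝ) :
    HasDerivAt (fun t => sineSum (fun n => A n t) z) (sineSum (fun n => A' n t) z) t := by
  refine hasDerivAt_tsum_of_isPreconnected (t := I) (y₀ := t) hB hI hI'.isPreconnected
    (fun n s hs => (hA n s hs).mul_const _) (fun n s hs => ?_) ht ?_ ht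
  · exact (abs_mul_sin_le _ _).trans (hb' n s hs)
  · exact summable_sine hB (fun n => hb n t ht) z

/-- Term-by-term differentiation of a sine series with time-dependent coefficients. -/
theorem contDiffOn_one_sineSum {A A' : ℕ → ℝ → ℝ} {B : ℕ → ℝ} {I : Set ℝ} (hI : IsOpen I)
    (hI' : I.OrdConnected) (hB : Summable B) (hA : ∀ n, ∀ t ∈ I, HasDerivAt (A n) (A' n t) t)
    (hc' : ∀ n, ContinuousOn (A' n) I) (hb : ∀ n, ∀ t ∈ I, dirichletFreq n * |A n t| ≤ B n)
    (hb' : ∀ n, ∀ t ∈ I, |A' n t| ≤ B n) :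
    ContDiffOn ℝ 1 (fun p : ℝ × ℝ => sineSum (fun n => A n p.1) p.2) (I ×ˢ univ) := by
  have hb0 : ∀ n, ∀ t ∈ I, |A n t| ≤ B n := fun n t ht =>
    (le_mul_of_one_le_left (abs_nonneg _) (one_le_dirichletFreq n)).trans (hb n t ht)
  have hbz : ∀ n, ∀ t ∈ I, |dirichletFreq n * A n t| ≤ B n := fun n t ht => by
    rw [abs_mul, abs_of_pos (dirichletFreq_pos n)]
    exact hb n t ht
  refine contDiffOn_one_of_partial (hI.prod isOpen_univ)
    (f := fun t z => sineSum (fun n => A n t) z)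
    (f₁ := fun t z => sineSum (fun n => A' n t) z)
    (f₂ := fun t z => ∑' n, dirichletFreq n * A n t * Real.cos (dirichletFreq n * z))
    (fun p hp => sineSum_hasDerivAt_time hI hI' hB hA hb0 hb' hp.1 p.2) (fun p hp => ?_)
    (continuousOn_sineSum hB hc' hb') ?_
  · refine hasDerivAt_tsum (y₀ := 0) hB (fun n z => hasDerivAt_mul_sin _ _ z) (fun n z => ?_) ?_ _
    · exact (abs_mul_cos_le _ _).trans (hbz n p.1 hp.1)
    · exact summable_sine hB (fun n => hb0 n p.1 hp.1) 0
  · refine continuousOn_tsum (fun n => ?_) hB fun n p hp =>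
      (abs_mul_cos_le _ _).trans (hbz n p.1 hp.1)
    have hAc : ContinuousOn (A n) I := fun t ht => (hA n t ht).continuousAt.continuousWithinAt
    exact (continuousOn_const.mul (hAc.comp continuousOn_fst fun p hp => hp.1)).mul
      (Continuous.continuousOn (by fun_prop))

theorem contDiff_two_sineSum {A B : ℕ → ℝ} (hB : Summable B)
    (hA : ∀ n, dirichletFreq n ^ 2 * |A n| ≤ B n) : ContDiff ℝ 2 (sineSum A) ∧
      iteratedDeriv 2 (sineSum A) = sineSum fun n => -(dirichletFreq n ^ 2) * A n := by
  have h1 : ∀ n, |dirichletFreq n * A n| ≤ B n := fun n => by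
    rw [abs_mul, abs_of_pos (dirichletFreq_pos n)]
    refine le_trans ?_ (hA n)
    rw [sq, mul_assoc]
    exact le_mul_of_one_le_left (mul_nonneg (dirichletFreq_pos n).le (abs_nonneg _))
      (one_le_dirichletFreq n)
  have h0 : ∀ n, |A n| ≤ B n := fun n => by
    refine le_trans ?_ (h1 n)
    rw [abs_mul, abs_of_pos (dirichletFreq_pos n)]
    exact le_mul_of_one_le_left (abs_nonneg _) (one_le_dirichletFreq n)
  have h2 : ∀ n, |-(dirichletFreq n ^ 2) * A n| ≤ B n := fun n => by
    rw [abs_mul, abs_neg, abs_of_pos (pow_pos (dirichletFreq_pos n) 2)]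
    exact hA n
  have d1 : ∀ z, HasDerivAt (sineSum A)
      (∑' n, dirichletFreq n * A n * Real.cos (dirichletFreq n * z)) z := fun z =>
    hasDerivAt_tsum (y₀ := 0) hB (fun n z => hasDerivAt_mul_sin _ _ z)
      (fun n z => (abs_mul_cos_le _ _).trans (h1 n)) (summable_sine hB h0 0) z
  have d2 : ∀ z, HasDerivAt (fun z => ∑' n, dirichletFreq n * A n * Real.cos (dirichletFreq n * z))
      (sineSum (fun n => -(dirichletFreq n ^ 2) * A n) z) z := fun z => by
    refine hasDerivAt_tsum (y₀ := 0)
      (g := fun n z => dirichletFreq n * A n * Real.cos (dirichletFreq n * z))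
      (g' := fun n z => -(dirichletFreq n ^ 2) * A n * Real.sin (dirichletFreq n * z))
      hB (fun n z => ?_) (fun n z => (abs_mul_sin_le _ _).trans (h2 n))
      (hB.of_norm_bounded fun n => (abs_mul_cos_le _ _).trans (h1 n)) z
    convert! hasDerivAt_mul_cos (dirichletFreq n * A n) (dirichletFreq n) z using 1
    ring
  have c2 : Continuous (sineSum fun n => -(dirichletFreq n ^ 2) * A n) :=
    continuous_tsum (fun n => by fun_prop) hB fun n z => (abs_mul_sin_le _ _).trans (h2 n)
  have e1 : deriv (sineSum A) = _ := funext fun z => (d1 z).deriv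
  have hC := contDiff_succ_of_hasDerivAt
    (contDiff_succ_of_hasDerivAt (n := 0) (contDiff_zero.2 c2) d2) d1
  refine ⟨by simpa using hC, ?_⟩
  rw [iteratedDeriv_succ, iteratedDeriv_one, e1]
  exact funext fun z => (d2 z).deriv

/-- The odd extension of a `C¹` function on `[0,∞)` vanishing at `0` is `C¹`. -/
theorem exists_odd_extension {v g : ℝ → ℝ} (hg : Continuous g) (hv : ∀ t, HasDerivAt v (g t) t)
    (hv0 : v 0 = 0) : ∃ V : ℝ → ℝ, (∀ t, HasDerivAt V (g |t|) t) ∧ (∀ t, |V t| = abs (v |t|)) ∧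
      ∀ t, 0 ≤ t → V t = v t := by
  have hc : Continuous fun s => g |s| := hg.comp continuous_abs
  have hpos : ∀ t, 0 ≤ t → ∫ s in (0 : ℝ)..t, g |s| = v t := fun t ht => by
    rw [intervalIntegral.integral_congr (g := g) fun s hs => ?_,
      intervalIntegral.integral_eq_sub_of_hasDerivAt (fun s _ => hv s)
        (hg.intervalIntegrable _ _), hv0, sub_zero]
    rw [uIcc_of_le ht] at hs
    simp only [abs_of_nonneg hs.1]
  refine ⟨fun t => 0 + ∫ s in (0 : ℝ)..t, g |s|, hasDerivAt_const_add_primitive hc 0,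
    fun t => ?_, fun t ht => (zero_add _).trans (hpos t ht)⟩
  simp only [zero_add]
  rcases le_total 0 t with ht | ht
  · rw [hpos t ht, abs_of_nonneg ht]
  · have h := intervalIntegral.integral_comp_neg (a := 0) (b := -t) (fun s => g |s|)
    simp only [abs_neg, neg_neg, neg_zero] at h
    rw [intervalIntegral.integral_symm, ← h, hpos (-t) (by linarith), abs_neg, abs_of_nonpos ht]

/-! ### Existence -/

/-- Uniform bounds for all modes at once: on `[0,T]` the amplitudes and the source are dominated by
a summable sequence, with one extra power of the frequency for `v` and, on `[ε,T]`, two for `y`. -/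
theorem exists_summable_mode_bound {K κ b : ℝ} {α β : ℝ → ℝ} (hα : Continuous α)
    (hβ : Continuous β) {c p q : ℕ → ℝ} (hc : Summable fun n => |c n|)
    (hp : Summable fun n => |p n|) (hq : Summable fun n => |q n|) {y v : ℕ → ℝ → ℝ}
    (hy0 : ∀ n, y n 0 = c n) (hv0 : ∀ n, v n 0 = 0)
    (hy : ∀ n t, HasDerivAt (y n) (-(dirichletFreq n ^ 2 + K) * y n t + κ * v n t
      + (α t * p n + β t * q n)) t)
    (hv : ∀ n t, HasDerivAt (v n) (y n t - b * v n t) t) (T : ℝ) {ε : ℝ} (hε : 0 < ε) :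
    ∃ B : ℕ → ℝ, Summable B ∧ (∀ n, ∀ t ∈ Icc 0 T, |y n t| ≤ B n ∧
      dirichletFreq n * |v n t| ≤ B n ∧ |α t * p n + β t * q n| ≤ B n) ∧
      ∀ n, ∀ t ∈ Icc ε T, dirichletFreq n ^ 2 * |y n t| ≤ B n := by
  obtain ⟨Mα, hMα⟩ := (isCompact_Icc (a := (0 : ℝ)) (b := T)).exists_bound_of_continuousOn
    hα.continuousOn
  obtain ⟨Mβ, hMβ⟩ := (isCompact_Icc (a := (0 : ℝ)) (b := T)).exists_bound_of_continuousOn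
    hβ.continuousOn
  set σ : ℕ → ℝ := fun n => |Mα| * |p n| + |Mβ| * |q n| with hσ
  have hσb : ∀ n, ∀ t ∈ Icc 0 T, |α t * p n + β t * q n| ≤ σ n := fun n t ht => by
    refine (abs_add_le _ _).trans ?_
    rw [abs_mul, abs_mul]
    have h1 : |α t| ≤ |Mα| := (hMα t ht).trans (le_abs_self _)
    have h2 : |β t| ≤ |Mβ| := (hMβ t ht).trans (le_abs_self _)
    simp only [hσ]
    gcongr
  have hσs : Summable σ := (hp.mul_left _).add (hq.mul_left _)
  set C := Real.exp ((2 * |K| + |κ| + 2 + 2 * |b|) * T) with hC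
  have hC0 : 0 < C := Real.exp_pos _
  set C' := 1 / ε + (|K| + |κ|) * C + 1 with hC'
  have hC'0 : 1 ≤ C' := by
    have : 0 ≤ 1 / ε + (|K| + |κ|) * C := by positivity
    linarith
  have hcσ : ∀ n, 0 ≤ |c n| + σ n := fun n => by positivity
  refine ⟨fun n => (C + C') * (|c n| + σ n), (hc.add hσs).mul_left _, fun n t ht => ?_,
    fun n t ht => ?_⟩
  · obtain ⟨h1, h2⟩ := mode_energy_bound (one_le_dirichletFreq n) (hy0 n) (hv0 n) (hy n) (hv n)
      (hσb n) t ht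
    have h3 := mul_nonneg (by linarith : 0 ≤ C' - 1) (hcσ n)
    have h4 := mul_nonneg hC0.le (hcσ n)
    have h5 := hσb n t ht
    have h6 := abs_nonneg (c n)
    have h7 := hcσ n
    refine ⟨?_, ?_, ?_⟩ <;> linarith
  · have h1 := mode_smoothing_bound (one_le_dirichletFreq n) hε (hy0 n) (hv0 n) (hy n) (hv n)
      (hσb n) t ht
    have h4 := mul_nonneg hC0.le (hcσ n)
    linarith

/-- The parabolic problem with homogeneous boundary conditions, memory variable `v` and a source
`α(t)P(z) + β(t)Q(z)` whose profiles vanish at the boundary. -/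
theorem exists_homogeneous_solution (K κ b : ℝ) {α β : ℝ → ℝ} (hα : Continuous α)
    (hβ : Continuous β) {Y₀ P Q : ℝ → ℝ} (hY : ContDiff ℝ 2 Y₀) (hY0 : Y₀ 0 = 0) (hY1 : Y₀ 1 = 0)
    (hP : ContDiff ℝ 2 P) (hP0 : P 0 = 0) (hP1 : P 1 = 0) (hQ : ContDiff ℝ 2 Q) (hQ0 : Q 0 = 0)
    (hQ1 : Q 1 = 0) : ∃ y v : ℝ → ℝ → ℝ,
      ContinuousOn (fun p : ℝ × ℝ => y p.1 p.2) (Ici 0 ×ˢ univ) ∧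
      ContDiffOn ℝ 1 (fun p : ℝ × ℝ => y p.1 p.2) (Ioi 0 ×ˢ univ) ∧
      (∀ t, 0 < t → ContDiff ℝ 2 (y t)) ∧
      ContDiff ℝ 1 (fun p : ℝ × ℝ => v p.1 p.2) ∧
      (∀ t, 0 < t → ∀ z ∈ Icc (0 : ℝ) 1, HasDerivAt (fun s => y s z)
        (iteratedDeriv 2 (y t) z - K * y t z + κ * v t z + (α t * P z + β t * Q z)) t) ∧
      (∀ t, 0 < t → ∀ z, HasDerivAt (fun s => v s z) (y t z - b * v t z) t) ∧
      (∀ t, y t 0 = 0) ∧ (∀ t, y t 1 = 0) ∧ (∀ z ∈ Icc (0 : ℝ) 1, y 0 z = Y₀ z) ∧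
      ∀ z, v 0 z = 0 := by
  obtain ⟨c, hc, hcY⟩ := exists_hasSum_sine_series hY hY0 hY1
  obtain ⟨p, hp, hpP⟩ := exists_hasSum_sine_series hP hP0 hP1
  obtain ⟨q, hq, hqQ⟩ := exists_hasSum_sine_series hQ hQ0 hQ1
  have hex := fun n : ℕ => exists_mode (dirichletFreq n ^ 2) K κ b (c n)
    (s := fun t => α t * p n + β t * q n) (by fun_prop)
  choose y v hy0 hv0 hy hv using hex
  have hbound := fun (T : ℝ) {ε : ℝ} (hε : 0 < ε) =>
    exists_summable_mode_bound hα hβ hc hp hq hy0 hv0 hy hv T hε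
  have hyc : ∀ n, Continuous (y n) := fun n =>
    continuous_iff_continuousAt.2 fun t => (hy n t).continuousAt
  have hvc : ∀ n, Continuous (v n) := fun n =>
    continuous_iff_continuousAt.2 fun t => (hv n t).continuousAt
  set g : ℕ → ℝ → ℝ := fun n t => y n t - b * v n t with hg
  have hgc : ∀ n, Continuous (g n) := fun n => (hyc n).sub (continuous_const.mul (hvc n))
  have hodd := fun n => exists_odd_extension (hgc n) (hv n) (hv0 n)
  choose V hV hVabs hVeq using hodd
  set y' : ℕ → ℝ → ℝ := fun n t => -(dirichletFreq n ^ 2 + K) * y n t + κ * v n t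
      + (α t * p n + β t * q n) with hy'
  have hy'c : ∀ n, Continuous (y' n) := fun n =>
    ((continuous_const.mul (hyc n)).add (continuous_const.mul (hvc n))).add (by fun_prop)
  -- the amplitude `v` is controlled by its weighted bound
  have hvle : ∀ {n t x}, dirichletFreq n * |v n t| ≤ x → |v n t| ≤ x := fun {n t x} h =>
    (le_mul_of_one_le_left (abs_nonneg _) (one_le_dirichletFreq n)).trans h
  -- bounds on the open interval `(t/2, t+1)` around a positive time
  have hloc : ∀ t : ℝ, 0 < t → ∃ B : ℕ → ℝ, Summable B ∧ ∀ n, ∀ s ∈ Ioo (t / 2) (t + 1),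
      dirichletFreq n ^ 2 * |y n s| ≤ B n ∧ dirichletFreq n * |y n s| ≤ B n ∧ |y n s| ≤ B n ∧
        |v n s| ≤ B n ∧ |g n s| ≤ B n ∧ |y' n s| ≤ B n := by
    intro t ht
    obtain ⟨B, hB, h1, h2⟩ := hbound (t + 1) (half_pos ht)
    refine ⟨fun n => (2 + |K| + |κ| + |b|) * B n, hB.mul_left _, fun n s hs => ?_⟩
    obtain ⟨a1, a2, a3⟩ := h1 n s ⟨by linarith [hs.1], hs.2.le⟩
    have a4 := h2 n s (Ioo_subset_Icc_self hs)
    have a5 := hvle a2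
    have hB0 : 0 ≤ B n := (abs_nonneg _).trans a1
    have a6 : dirichletFreq n * |y n s| ≤ B n := by
      refine le_trans ?_ a4
      rw [sq, mul_assoc]
      exact le_mul_of_one_le_left (mul_nonneg (dirichletFreq_pos n).le (abs_nonneg _))
        (one_le_dirichletFreq n)
    have a7 : |g n s| ≤ B n + |b| * B n := by
      refine (abs_sub _ _).trans ?_
      rw [abs_mul]
      gcongr
    have a8 : |y' n s| ≤ (B n + |K| * B n) + |κ| * B n + B n := by
      refine (abs_add_three _ _ _).trans ?_
      rw [abs_mul, abs_mul, abs_neg]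
      have : |dirichletFreq n ^ 2 + K| ≤ dirichletFreq n ^ 2 + |K| := by
        refine (abs_add_le _ _).trans ?_
        rw [abs_of_pos (pow_pos (dirichletFreq_pos n) 2)]
      have h3 : |dirichletFreq n ^ 2 + K| * |y n s| ≤ B n + |K| * B n := by
        calc _ ≤ (dirichletFreq n ^ 2 + |K|) * |y n s| :=
              mul_le_mul_of_nonneg_right this (abs_nonneg _)
          _ = dirichletFreq n ^ 2 * |y n s| + |K| * |y n s| := by ring
          _ ≤ _ := add_le_add a4 (mul_le_mul_of_nonneg_left a1 (abs_nonneg _))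
      have h4 : |κ| * |v n s| ≤ |κ| * B n := mul_le_mul_of_nonneg_left a5 (abs_nonneg _)
      linarith
    have e1 : 0 ≤ |K| * B n := by positivity
    have e2 : 0 ≤ |κ| * B n := by positivity
    have e3 : 0 ≤ |b| * B n := by positivity
    refine ⟨?_, ?_, ?_, ?_, ?_, ?_⟩ <;> linarith
  have hmem : ∀ {t : ℝ}, 0 < t → t ∈ Ioo (t / 2) (t + 1) := fun ht =>
    ⟨by linarith, by linarith⟩
  have hdy : ∀ t, 0 < t → ∀ z, HasDerivAt (fun s => sineSum (fun n => y n s) z)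
      (sineSum (fun n => y' n t) z) t := by
    intro t ht z
    obtain ⟨B, hB, hb⟩ := hloc t ht
    exact sineSum_hasDerivAt_time isOpen_Ioo ordConnected_Ioo hB (fun n s _ => hy n s)
      (fun n s hs => (hb n s hs).2.2.1) (fun n s hs => (hb n s hs).2.2.2.2.2) (hmem ht) z
  have hdv : ∀ t, 0 < t → ∀ z, HasDerivAt (fun s => sineSum (fun n => V n s) z)
      (sineSum (fun n => g n |t|) z) t := by
    intro t ht z
    obtain ⟨B, hB, hb⟩ := hloc t ht
    have hpos : ∀ s ∈ Ioo (t / 2) (t + 1), |s| = s := fun s hs =>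
      abs_of_pos ((half_pos ht).trans hs.1)
    refine sineSum_hasDerivAt_time isOpen_Ioo ordConnected_Ioo hB (A' := fun n t => g n |t|)
      (fun n s _ => hV n s) (fun n s hs => ?_) (fun n s hs => ?_) (hmem ht) z
    · rw [hVabs, hpos s hs]; exact (hb n s hs).2.2.2.1
    · rw [hpos s hs]; exact (hb n s hs).2.2.2.2.1
  refine ⟨fun t => sineSum fun n => y n t, fun t => sineSum fun n => V n t, ?_, ?_, ?_, ?_, ?_, ?_,
    fun t => sineSum_zero _, fun t => sineSum_one _, fun z hz => ?_, fun z => ?_⟩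
  · rintro ⟨t, z⟩ ⟨ht, -⟩
    obtain ⟨B, hB, h1, -⟩ := hbound (t + 1) zero_lt_one
    have h := continuousOn_sineSum (I := Icc 0 (t + 1)) hB (fun n => (hyc n).continuousOn)
      (fun n s hs => (h1 n s hs).1) (t, z) ⟨⟨ht, by simp⟩, mem_univ _⟩
    refine h.mono_of_mem_nhdsWithin ?_
    have : (Iio (t + 1) ×ˢ univ : Set (ℝ × ℝ)) ∈ nhds (t, z) :=
      (isOpen_Iio.prod isOpen_univ).mem_nhds ⟨by simp, mem_univ _⟩
    filter_upwards [self_mem_nhdsWithin, mem_nhdsWithin_of_mem_nhds this] with p hp1 hp2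
    exact ⟨⟨hp1.1, le_of_lt hp2.1⟩, mem_univ _⟩
  · rintro ⟨t, z⟩ ⟨ht, -⟩
    obtain ⟨B, hB, hb⟩ := hloc t ht
    have h := contDiffOn_one_sineSum (I := Ioo (t / 2) (t + 1)) isOpen_Ioo ordConnected_Ioo hB
      (fun n s _ => hy n s) (fun n => (hy'c n).continuousOn) (fun n s hs => (hb n s hs).2.1)
      (fun n s hs => (hb n s hs).2.2.2.2.2)
    exact (h.contDiffAt ((isOpen_Ioo.prod isOpen_univ).mem_nhds
      ⟨hmem ht, mem_univ _⟩)).contDiffWithinAt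
  · intro t ht
    obtain ⟨B, hB, hb⟩ := hloc t ht
    exact (contDiff_two_sineSum hB fun n => (hb n t (hmem ht)).1).1
  · rw [contDiff_iff_contDiffAt]
    rintro ⟨t, z⟩
    obtain ⟨B, hB, h1, -⟩ := hbound (|t| + 1) zero_lt_one
    have hB0 : ∀ n, 0 ≤ B n := fun n =>
      (abs_nonneg _).trans (h1 n 0 ⟨le_rfl, by positivity⟩).1
    have hs' : ∀ s ∈ Ioo (-(|t| + 1)) (|t| + 1), |s| ∈ Icc 0 (|t| + 1) := fun s hs =>
      ⟨abs_nonneg _, (abs_lt.2 hs).le⟩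
    have h := contDiffOn_one_sineSum (A := V) (A' := fun n s => g n |s|)
      (I := Ioo (-(|t| + 1)) (|t| + 1)) isOpen_Ioo
      ordConnected_Ioo (hB.mul_left (1 + |b|)) (fun n s _ => hV n s)
      (fun n => ((hgc n).comp continuous_abs).continuousOn) (fun n s hs => ?_) (fun n s hs => ?_)
    · exact h.contDiffAt ((isOpen_Ioo.prod isOpen_univ).mem_nhds
        ⟨abs_lt.1 (lt_add_one _), mem_univ _⟩)
    · rw [hVabs]
      have := (h1 n _ (hs' s hs)).2.1
      have := mul_nonneg (abs_nonneg b) (hB0 n)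
      linarith
    · refine (abs_sub _ _).trans ?_
      rw [abs_mul]
      obtain ⟨a1, a2, -⟩ := h1 n _ (hs' s hs)
      have := mul_le_mul_of_nonneg_left (hvle a2) (abs_nonneg b)
      linarith
  · intro t ht z hz
    obtain ⟨B, hB, hb⟩ := hloc t ht
    have hb' := fun n => hb n t (hmem ht)
    convert! hdy t ht z using 1
    rw [(contDiff_two_sineSum hB fun n => (hb' n).1).2]
    have s1 := (summable_sine (A := fun n => -(dirichletFreq n ^ 2) * y n t) hB (fun n => by
      rw [abs_mul, abs_neg, abs_of_pos (pow_pos (dirichletFreq_pos n) 2)]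
      exact (hb' n).1) z).hasSum
    have s2 := (summable_sine (A := fun n => y n t) hB (fun n => (hb' n).2.2.1) z).hasSum
    have s3 := (summable_sine (A := fun n => V n t) hB (fun n => by
      rw [hVeq n t ht.le]; exact (hb' n).2.2.2.1) z).hasSum
    have s4 := ((hpP z hz).mul_left (α t)).add ((hqQ z hz).mul_left (β t))
    refine HasSum.unique (((s1.sub (s2.mul_left K)).add (s3.mul_left κ)).add s4) ?_
    have s5 := (summable_sine (A := fun n => y' n t) hB (fun n => (hb' n).2.2.2.2.2) z).hasSum
    convert! s5 using 1
    funext n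
    simp only [hy', hVeq n t ht.le]
    ring
  · intro t ht z
    obtain ⟨B, hB, hb⟩ := hloc t ht
    have hb' := fun n => hb n t (hmem ht)
    convert! hdv t ht z using 1
    have s2 := (summable_sine (A := fun n => y n t) hB (fun n => (hb' n).2.2.1) z).hasSum
    have s3 := (summable_sine (A := fun n => V n t) hB (fun n => by
      rw [hVeq n t ht.le]; exact (hb' n).2.2.2.1) z).hasSum
    refine HasSum.unique (s2.sub (s3.mul_left b)) ?_
    have s5 := (summable_sine (A := fun n => g n |t|) hB (fun n => by
      rw [abs_of_pos ht]; exact (hb' n).2.2.2.2.1) z).hasSum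
    convert! s5 using 1
    funext n
    simp only [hg, hVeq n t ht.le, abs_of_pos ht]
    ring
  · simp only [sineSum, hy0]
    exact (hcY z hz).tsum_eq
  · simp [sineSum, hVeq _ 0 le_rfl, hv0]

/-- The memory integral `I(t) = ∫₀ᵗ e^{-b(t-s)} f(s) ds`, described by its differential equation. -/
theorem exists_memory (b : ℝ) {f : ℝ → ℝ} (hf : Continuous f) :
    ∃ I : ℝ → ℝ, I 0 = 0 ∧ ContDiff ℝ 1 I ∧ ∀ t, HasDerivAt I (f t - b * I t) t := by
  obtain ⟨I, h0, hI⟩ := exists_hasDerivAt_linear_inhomogeneous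
    ((-b) • ContinuousLinearMap.id ℝ ℝ) hf 0
  have hI' : ∀ t, HasDerivAt I (f t - b * I t) t := fun t => by
    convert! hI t using 1
    simp
    ring
  have hc : Continuous I := continuous_iff_continuousAt.2 fun t => (hI t).continuousAt
  refine ⟨I, h0, ?_, hI'⟩
  simpa using contDiff_succ_of_hasDerivAt (n := 0)
    (contDiff_zero.2 (hf.sub (continuous_const.mul hc))) hI'

/-- Existence for globally defined smooth data: `u₁` and `u₂` are explicit lifts plus the solution
of a problem with homogeneous boundary conditions. The lifts `e^{-bt} P(z)` and `q(t) Q(z)`,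
`P'' = -r b u₂₀`, `Q'' = 1 - z`, remove the part of the source that does not vanish at the
boundary. -/
theorem exists_classicalSolution (K r a b : ℝ) {D U W : ℝ → ℝ} (hD : ContDiff ℝ 2 D)
    (hU : ContDiff ℝ 1 U) (hW : ContDiff ℝ 2 W) (hW1 : W 1 = 0) (hDW : D 0 = W 0) :
    ∃ u₁ u₂ : ℝ → ℝ → ℝ, IsClassicalSolution K r a b D W U u₁ u₂ := by
  obtain ⟨P, hP, hP0, hP1, hP2⟩ := exists_contDiff_two_dirichlet
    (g := fun z => -(r * b) * U z) (continuous_const.mul hU.continuous)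
  obtain ⟨Q, hQ, hQ0, hQ1, hQ2⟩ := exists_contDiff_two_dirichlet
    (g := fun z => 1 - z) (by fun_prop)
  obtain ⟨ID, hID0, hIDc, hID⟩ := exists_memory b hD.continuous
  have hD' : ContDiff ℝ 1 (deriv D) := by
    have h := hD
    rw [show (2 : WithTop ℕ∞) = 1 + 1 by norm_num, contDiff_succ_iff_deriv] at h
    exact h.2.2
  obtain ⟨-, -, hDd, -⟩ := hasDerivAt_of_contDiff_two hD
  set κ := r * b * a with hκ
  set q : ℝ → ℝ := fun t => deriv D t + K * D t - κ * ID t with hq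
  have hqc : ContDiff ℝ 1 q :=
    (hD'.add (contDiff_const.mul (hD.of_le one_le_two))).sub (contDiff_const.mul hIDc)
  have hq' : Continuous (deriv q) := hqc.continuous_deriv le_rfl
  have hqd : ∀ t, HasDerivAt q (deriv q t) t := fun t =>
    (hqc.differentiable one_ne_zero t).hasDerivAt
  obtain ⟨Iq, hIq0, hIqc, hIq⟩ := exists_memory b hqc.continuous
  have hexp : ∀ t, HasDerivAt (fun t => Real.exp (-b * t)) (-b * Real.exp (-b * t)) t := fun t => by
    have h : HasDerivAt (fun t => -b * t) (-b) t := by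
      simpa using (hasDerivAt_id' t).const_mul (-b)
    convert! h.exp using 1
    ring
  obtain ⟨y, v, hyc, hy1, hy2, hv1, hyt, hvt, hy0, hyone, hyi, hvi⟩ :=
    exists_homogeneous_solution K κ b
      (α := fun t => (b - K + κ * t) * Real.exp (-b * t))
      (β := fun t => -(deriv q t + K * q t - κ * Iq t))
      (by fun_prop)
      ((hq'.add (continuous_const.mul hqc.continuous)).sub
        (continuous_const.mul hIqc.continuous)).neg
      (Y₀ := fun z => W z - (1 - z) * D 0 - P z - q 0 * Q z)
      (by fun_prop) (by simp [hP0, hQ0, hDW]) (by simp [hP1, hQ1, hW1])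
      hP hP0 hP1 hQ hQ0 hQ1
  have hP' : ContDiff ℝ 1 P := hP.of_le one_le_two
  have hQ' : ContDiff ℝ 1 Q := hQ.of_le one_le_two
  have hD1 : ContDiff ℝ 1 D := hD.of_le one_le_two
  have hlift : ContDiff ℝ 1 fun p : ℝ × ℝ =>
      (1 - p.2) * D p.1 + Real.exp (-b * p.1) * P p.2 + q p.1 * Q p.2 := by fun_prop
  have hu₂ : ContDiff ℝ 1 fun p : ℝ × ℝ => Real.exp (-b * p.1) * U p.2 + a * ((1 - p.2) * ID p.1
      + p.1 * Real.exp (-b * p.1) * P p.2 + Iq p.1 * Q p.2 + v p.1 p.2) := by fun_prop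
  refine ⟨fun t z => (1 - z) * D t + Real.exp (-b * t) * P z + q t * Q z + y t z,
    fun t z => Real.exp (-b * t) * U z + a * ((1 - z) * ID t + t * Real.exp (-b * t) * P z
      + Iq t * Q z + v t z), ?_⟩
  refine
    { continuousOn_fst := hlift.continuous.continuousOn.add
        (hyc.mono (prod_mono subset_rfl (subset_univ _)))
      contDiffOn_fst := hlift.contDiffOn.add (hy1.mono (prod_mono subset_rfl (subset_univ _)))
      contDiffOn_profile := fun t ht => ?_
      contDiffOn_snd := hu₂.contDiffOn
      parabolic := fun t ht z hz => ?_
      hyperbolic := fun t ht z hz => ?_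
      boundary_zero := fun t _ => by simp [hP0, hQ0, hy0]
      boundary_one := fun t _ => by simp [hP1, hQ1, hyone]
      initial_fst := fun z hz => ?_
      initial_snd := fun z _ => by simp [hID0, hIq0, hvi] }
  · have hyt2 := hy2 t ht
    have : ContDiff ℝ 2 fun z => (1 - z) * D t + Real.exp (-b * t) * P z + q t * Q z + y t z := by
      fun_prop
    exact this.contDiffOn
  · have hz' := Ioo_subset_Icc_self hz
    have ht1 : HasDerivAt
        (fun s => (1 - z) * D s + Real.exp (-b * s) * P z + q s * Q z + y s z) _ t :=
      ((((hDd t).const_mul (1 - z)).fun_add ((hexp t).mul_const (P z))).fun_add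
        ((hqd t).mul_const (Q z))).fun_add (hyt t ht z hz')
    obtain ⟨-, -, P1, P2⟩ := hasDerivAt_of_contDiff_two hP
    obtain ⟨-, -, Q1, Q2⟩ := hasDerivAt_of_contDiff_two hQ
    obtain ⟨-, -, y1, y2⟩ := hasDerivAt_of_contDiff_two (hy2 t ht)
    have d1 : deriv (fun z => (1 - z) * D t + Real.exp (-b * t) * P z + q t * Q z + y t z)
        = fun z => -1 * D t + Real.exp (-b * t) * deriv P z + q t * deriv Q z + deriv (y t) z :=
      funext fun z => (((((hasDerivAt_id' z).const_sub 1).mul_const (D t)).fun_add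
        ((P1 z).const_mul _)).fun_add ((Q1 z).const_mul _) |>.fun_add (y1 z)).deriv
    have d2 : HasDerivAt (fun z => -1 * D t + Real.exp (-b * t) * deriv P z + q t * deriv Q z
        + deriv (y t) z) _ z :=
      ((((P2 z).const_mul (Real.exp (-b * t))).const_add (-1 * D t)).fun_add
        ((Q2 z).const_mul (q t))).fun_add (y2 z)
    have e2 : iteratedDeriv 2
        (fun z => (1 - z) * D t + Real.exp (-b * t) * P z + q t * Q z + y t z) z =
        Real.exp (-b * t) * iteratedDeriv 2 P z + q t * iteratedDeriv 2 Q z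
          + iteratedDeriv 2 (y t) z := by
      rw [iteratedDeriv_succ, iteratedDeriv_one, d1]
      exact d2.deriv
    rw [ht1.deriv, e2, hP2, hQ2]
    have eq : q t = deriv D t + K * D t - κ * ID t := rfl
    linear_combination -(1 - z) * eq
  · have ht1 : HasDerivAt (fun s => Real.exp (-b * s) * U z + a * ((1 - z) * ID s
        + s * Real.exp (-b * s) * P z + Iq s * Q z + v s z)) _ t :=
      ((hexp t).mul_const (U z)).fun_add ((((((hID t).const_mul (1 - z)).fun_add
        (((hasDerivAt_id' t).fun_mul (hexp t)).mul_const (P z))).fun_add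
        ((hIq t).mul_const (Q z))).fun_add (hvt t ht z)).const_mul a)
    rw [ht1.deriv]
    ring
  · simp only [mul_zero, Real.exp_zero, hyi z hz]
    ring

/-! ### Uniqueness -/

/-- The time derivative of a function that is `C¹` on `(0,∞) × [0,1]` in the one-sided sense is
two-sided, also on the lateral boundary. -/
theorem exists_time_derivative {f : ℝ → ℝ → ℝ}
    (hf : ContDiffOn ℝ 1 (fun p : ℝ × ℝ => f p.1 p.2) (Ioi 0 ×ˢ Icc 0 1)) :
    ∃ f' : ℝ → ℝ → ℝ, ContinuousOn (fun p : ℝ × ℝ => f' p.1 p.2) (Ioi 0 ×ˢ Icc 0 1) ∧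
      ∀ t, 0 < t → ∀ z ∈ Icc (0 : ℝ) 1, HasDerivAt (fun s => f s z) (f' t z) t := by
  have hu : UniqueDiffOn ℝ (Ioi (0 : ℝ) ×ˢ Icc (0 : ℝ) 1) :=
    (uniqueDiffOn_Ioi 0).prod (uniqueDiffOn_Icc zero_lt_one)
  refine ⟨fun t z => fderivWithin ℝ (fun p : ℝ × ℝ => f p.1 p.2) (Ioi 0 ×ˢ Icc 0 1) (t, z) (1, 0),
    (hf.continuousOn_fderivWithin hu le_rfl).clm_apply continuousOn_const, fun t ht z hz => ?_⟩
  have h1 := (hf.differentiableOn one_ne_zero (t, z) ⟨ht, hz⟩).hasFDerivWithinAt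
  have h2 : HasDerivWithinAt (fun s : ℝ => (s, z)) (1, 0) (Ioi 0) t :=
    (hasDerivWithinAt_id t _).prodMk (hasDerivWithinAt_const t _ z)
  exact (h1.comp_hasDerivWithinAt (f := fun s : ℝ => (s, z)) t h2 fun s hs => ⟨hs, hz⟩).hasDerivAt
     (Ioi_mem_nhds ht)

/-- Continuity of a space integral in time, up to `t = 0`. -/
theorem continuousOn_integral_space {F : ℝ → ℝ → ℝ}
    (hF : ContinuousOn (fun p : ℝ × ℝ => F p.1 p.2) (Ici 0 ×ˢ Icc 0 1)) :
    ContinuousOn (fun t => ∫ z in (0 : ℝ)..1, F t z) (Ici 0) := by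
  have hG : Continuous (Function.uncurry fun t z : ℝ =>
      F (max t 0) (projIcc (0 : ℝ) 1 zero_le_one z)) :=
    hF.comp_continuous (f := fun p : ℝ × ℝ => (max p.1 0, (projIcc (0 : ℝ) 1 zero_le_one p.2 : ℝ)))
      ((continuous_fst.max continuous_const).prodMk
        (continuous_subtype_val.comp (continuous_projIcc.comp continuous_snd)))
      fun p => ⟨le_max_right p.1 0, (projIcc (0 : ℝ) 1 zero_le_one p.2).2⟩
  refine (intervalIntegral.continuous_parametric_intervalIntegral_of_continuous' (μ := volume)
    hG 0 1).continuousOn.congr fun t ht => ?_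
  refine intervalIntegral.integral_congr fun z hz => ?_
  rw [uIcc_of_le zero_le_one] at hz
  simp only [max_eq_left (mem_Ici.1 ht), projIcc_of_mem zero_le_one hz]

theorem hasDerivAt_integral_space {F F' : ℝ → ℝ → ℝ}
    (hF : ContinuousOn (fun p : ℝ × ℝ => F p.1 p.2) (Ici 0 ×ˢ Icc 0 1))
    (hF' : ContinuousOn (fun p : ℝ × ℝ => F' p.1 p.2) (Ioi 0 ×ˢ Icc 0 1))
    (hd : ∀ t, 0 < t → ∀ z ∈ Icc (0 : ℝ) 1, HasDerivAt (fun s => F s z) (F' t z) t)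
    {t : ℝ} (ht : 0 < t) :
    HasDerivAt (fun t => ∫ z in (0 : ℝ)..1, F t z) (∫ z in (0 : ℝ)..1, F' t z) t := by
  have hslice : ∀ s, 0 ≤ s → ContinuousOn (F s) (Icc 0 1) := fun s hs =>
    hF.comp (f := fun z => (s, z)) (by fun_prop) fun z hz => ⟨hs, hz⟩
  have hslice' : ContinuousOn (F' t) (Icc 0 1) :=
    hF'.comp (f := fun z => (t, z)) (by fun_prop) fun z hz => ⟨ht, hz⟩
  obtain ⟨M, hM⟩ := ((isCompact_Icc (a := t / 2) (b := t + 1)).prod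
    (isCompact_Icc (a := (0 : ℝ)) (b := 1))).exists_bound_of_continuousOn
    (hF'.mono (prod_mono (fun s hs => (half_pos ht).trans_le hs.1) subset_rfl))
  have hIoc : uIoc (0 : ℝ) 1 ⊆ Icc 0 1 := by
    rw [uIoc_of_le zero_le_one]; exact Ioc_subset_Icc_self
  refine (intervalIntegral.hasDerivAt_integral_of_dominated_loc_of_deriv_le
    (F := F) (F' := F') (bound := fun _ => M) (s := Ioo (t / 2) (t + 1))
    (Ioo_mem_nhds (by linarith) (by linarith)) ?_ ?_ ?_ ?_ intervalIntegrable_const ?_).2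
  · filter_upwards [Ioi_mem_nhds ht] with s hs
    exact ((hslice s (le_of_lt hs)).mono hIoc).aestronglyMeasurable measurableSet_uIoc
  · exact (hslice t ht.le).intervalIntegrable_of_Icc zero_le_one
  · exact (hslice'.mono hIoc).aestronglyMeasurable measurableSet_uIoc
  · exact Filter.Eventually.of_forall fun z hz s hs =>
      hM (s, z) ⟨Ioo_subset_Icc_self hs, hIoc hz⟩
  · exact Filter.Eventually.of_forall fun z hz s hs =>
      hd s ((half_pos ht).trans hs.1) z (hIoc hz)

theorem iteratedDeriv_two_congr_Ioo {f g : ℝ → ℝ} (h : EqOn f g (Icc 0 1)) :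
    EqOn (iteratedDeriv 2 f) (iteratedDeriv 2 g) (Ioo 0 1) :=
  (h.mono Ioo_subset_Icc_self).iteratedDeriv_of_isOpen isOpen_Ioo 2

/-- The Dirichlet Laplacian on `[0,1]` is dissipative. -/
theorem integral_mul_iteratedDeriv_two_nonpos {g : ℝ → ℝ} (hg : ContDiff ℝ 2 g) (h0 : g 0 = 0)
    (h1 : g 1 = 0) : ∫ z in (0 : ℝ)..1, g z * iteratedDeriv 2 g z ≤ 0 := by
  obtain ⟨c1, c2, d1, d2⟩ := hasDerivAt_of_contDiff_two hg
  rw [intervalIntegral.integral_mul_deriv_eq_deriv_mul (fun z _ => d1 z) (fun z _ => d2 z)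
    (c1.intervalIntegrable _ _) (c2.intervalIntegrable _ _), h0, h1]
  have : 0 ≤ ∫ z in (0 : ℝ)..1, deriv g z * deriv g z :=
    intervalIntegral.integral_nonneg zero_le_one fun z _ => mul_self_nonneg _
  linarith

/-- Energy method: with zero data, `∫₀¹ (u₁² + u₂²) dz` satisfies a Grönwall inequality. -/
theorem IsClassicalSolution.eq_zero {K r a b : ℝ} {e₁ e₂ : ℝ → ℝ → ℝ}
    (h : IsClassicalSolution K r a b (fun _ => 0) (fun _ => 0) (fun _ => 0) e₁ e₂) :
    ∀ t, 0 ≤ t → ∀ z ∈ Icc (0 : ℝ) 1, e₁ t z = 0 ∧ e₂ t z = 0 := by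
  have hS : Ioi (0 : ℝ) ×ˢ Icc (0 : ℝ) 1 ⊆ Ici 0 ×ˢ Icc 0 1 := prod_mono Ioi_subset_Ici_self
    subset_rfl
  obtain ⟨f₁, hf₁c, hf₁⟩ := exists_time_derivative h.contDiffOn_fst
  obtain ⟨f₂, hf₂c, hf₂⟩ := exists_time_derivative (h.contDiffOn_snd.mono hS)
  have hc₁ := h.continuousOn_fst
  have hc₂ := h.contDiffOn_snd.continuousOn
  set F : ℝ → ℝ → ℝ := fun t z => e₁ t z ^ 2 + e₂ t z ^ 2 with hF
  set F' : ℝ → ℝ → ℝ := fun t z => 2 * e₁ t z * f₁ t z + 2 * e₂ t z * f₂ t z with hF'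
  have hFc : ContinuousOn (fun p : ℝ × ℝ => F p.1 p.2) (Ici 0 ×ˢ Icc 0 1) :=
    (hc₁.pow 2).add (hc₂.pow 2)
  have hF'c : ContinuousOn (fun p : ℝ × ℝ => F' p.1 p.2) (Ioi 0 ×ˢ Icc 0 1) :=
    ((continuousOn_const.mul (hc₁.mono hS)).mul hf₁c).add
      ((continuousOn_const.mul (hc₂.mono hS)).mul hf₂c)
  have hFd : ∀ t, 0 < t → ∀ z ∈ Icc (0 : ℝ) 1, HasDerivAt (fun s => F s z) (F' t z) t := by
    intro t ht z hz
    convert! ((hf₁ t ht z hz).fun_pow 2).fun_add ((hf₂ t ht z hz).fun_pow 2) using 1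
    simp [hF']
  set M := |r * b| + |a| + 2 * |K| + 2 * |b| with hM
  have hle : ∀ t, 0 < t → ∫ z in (0 : ℝ)..1, F' t z ≤ M * ∫ z in (0 : ℝ)..1, F t z := by
    intro t ht
    obtain ⟨G, hG, hGe⟩ := (h.contDiffOn_profile t ht).exists_contDiff_two_eqOn_Icc
    have hG2 := iteratedDeriv_two_congr_Ioo hGe
    have hGc : Continuous (iteratedDeriv 2 G) := hG.continuous_iteratedDeriv 2 le_rfl
    have hdis := integral_mul_iteratedDeriv_two_nonpos hG
      (by rw [hGe (left_mem_Icc.2 zero_le_one)]; exact h.boundary_zero t ht.le)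
      (by rw [hGe (right_mem_Icc.2 zero_le_one)]; exact h.boundary_one t ht.le)
    have hFi : IntervalIntegrable (F t) volume 0 1 :=
      (hFc.comp (f := fun z => (t, z)) (by fun_prop) fun z hz =>
        ⟨ht.le, hz⟩).intervalIntegrable_of_Icc zero_le_one
    have hF'i : IntervalIntegrable (F' t) volume 0 1 :=
      (hF'c.comp (f := fun z => (t, z)) (by fun_prop) fun z hz =>
        ⟨ht, hz⟩).intervalIntegrable_of_Icc zero_le_one
    have hGi : IntervalIntegrable (fun z => 2 * (G z * iteratedDeriv 2 G z)) volume 0 1 :=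
      (continuous_const.mul (hG.continuous.mul hGc)).intervalIntegrable _ _
    have hmono : ∫ z in (0 : ℝ)..1, F' t z
        ≤ ∫ z in (0 : ℝ)..1, (2 * (G z * iteratedDeriv 2 G z) + M * F t z) := by
      refine intervalIntegral.integral_mono_on_of_le_Ioo zero_le_one hF'i
        (hGi.add (hFi.const_mul M)) fun z hz => ?_
      have hz' := Ioo_subset_Icc_self hz
      have p := h.parabolic t ht z hz
      have q := h.hyperbolic t ht z hz
      rw [(hf₁ t ht z hz').deriv, ← hG2 hz] at p
      rw [(hf₂ t ht z hz').deriv] at q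
      have ep : f₁ t z = iteratedDeriv 2 G z - K * e₁ t z + r * b * e₂ t z := by linarith
      have eq : f₂ t z = a * e₁ t z - b * e₂ t z := by linarith
      simp only [hF', hF, ep, eq, hGe hz', hM]
      generalize e₁ t z = x
      generalize e₂ t z = y
      generalize iteratedDeriv 2 G z = w
      have hxy : |2 * (x * y)| ≤ x ^ 2 + y ^ 2 := by
        rw [abs_le]; constructor <;> nlinarith [sq_nonneg (x + y), sq_nonneg (x - y)]
      have hcr : ∀ c : ℝ, c * (2 * (x * y)) ≤ |c| * (x ^ 2 + y ^ 2) := fun c => by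
        refine (le_abs_self _).trans ?_
        rw [abs_mul]
        exact mul_le_mul_of_nonneg_left hxy (abs_nonneg c)
      have k1 := hcr (r * b)
      have k2 := hcr a
      have k3 : -K * x ^ 2 ≤ |K| * x ^ 2 :=
        mul_le_mul_of_nonneg_right (neg_le_abs K) (sq_nonneg x)
      have k4 : -b * y ^ 2 ≤ |b| * y ^ 2 :=
        mul_le_mul_of_nonneg_right (neg_le_abs b) (sq_nonneg y)
      have k5 : 0 ≤ |K| * y ^ 2 := by positivity
      have k6 : 0 ≤ |b| * x ^ 2 := by positivity
      linarith
    rw [intervalIntegral.integral_add hGi (hFi.const_mul M), intervalIntegral.integral_const_mul,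
      intervalIntegral.integral_const_mul] at hmono
    linarith
  intro t ht z hz
  have hanti := antitoneOn_exp_mul_of_deriv_le (M := M) (T := t)
    ((continuousOn_integral_space hFc).mono Icc_subset_Ici_self)
    (fun s hs => hasDerivAt_integral_space hFc hF'c hFd hs.1) (fun s hs => hle s hs.1)
  have h0 := hanti (left_mem_Icc.2 ht) (right_mem_Icc.2 ht) ht
  have hinit : ∫ z in (0 : ℝ)..1, F 0 z = 0 := by
    rw [intervalIntegral.integral_congr (g := fun _ => (0 : ℝ)) fun z hz => ?_]
    · simp
    · rw [uIcc_of_le zero_le_one] at hz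
      simp only [hF, h.initial_fst z hz, h.initial_snd z hz]
      norm_num
  simp only [hinit, mul_zero] at h0
  have hE : ∫ z in (0 : ℝ)..1, F t z ≤ 0 := by
    by_contra hpos
    push Not at hpos
    exact absurd h0 (not_le.2 (mul_pos (Real.exp_pos _) hpos))
  have hFz : F t z ≤ 0 := by
    by_contra hpos
    push Not at hpos
    exact absurd hE (not_le.2 (intervalIntegral.integral_pos zero_lt_one
      (hFc.comp (f := fun z => (t, z)) (by fun_prop) fun z hz => ⟨ht, hz⟩)
      (fun z _ => by positivity) ⟨z, hz, hpos⟩))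
  have s1 := sq_nonneg (e₁ t z)
  have s2 := sq_nonneg (e₂ t z)
  simp only [hF] at hFz
  exact ⟨pow_eq_zero_iff two_ne_zero |>.1 (by linarith), pow_eq_zero_iff two_ne_zero |>.1
    (by linarith)⟩

theorem IsClassicalSolution.sub {K r a b : ℝ} {d u₁₀ u₂₀ : ℝ → ℝ} {u₁ u₂ v₁ v₂ : ℝ → ℝ → ℝ}
    (hv : IsClassicalSolution K r a b d u₁₀ u₂₀ v₁ v₂)
    (hu : IsClassicalSolution K r a b d u₁₀ u₂₀ u₁ u₂) :
    IsClassicalSolution K r a b (fun _ => 0) (fun _ => 0) (fun _ => 0)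
      (fun t z => v₁ t z - u₁ t z) (fun t z => v₂ t z - u₂ t z) where
  continuousOn_fst := hv.continuousOn_fst.sub hu.continuousOn_fst
  contDiffOn_fst := hv.contDiffOn_fst.sub hu.contDiffOn_fst
  contDiffOn_profile t ht := (hv.contDiffOn_profile t ht).sub (hu.contDiffOn_profile t ht)
  contDiffOn_snd := hv.contDiffOn_snd.sub hu.contDiffOn_snd
  parabolic t ht z hz := by
    obtain ⟨f, -, hf⟩ := exists_time_derivative hv.contDiffOn_fst
    obtain ⟨g, -, hg⟩ := exists_time_derivative hu.contDiffOn_fst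
    have hz' := Ioo_subset_Icc_self hz
    have h1 := hv.parabolic t ht z hz
    have h2 := hu.parabolic t ht z hz
    have hn : Icc (0 : ℝ) 1 ∈ nhds z := Icc_mem_nhds hz.1 hz.2
    rw [(hf t ht z hz').deriv] at h1
    rw [(hg t ht z hz').deriv] at h2
    rw [((hf t ht z hz').fun_sub (hg t ht z hz')).deriv, iteratedDeriv_fun_sub
      ((hv.contDiffOn_profile t ht).contDiffAt hn) ((hu.contDiffOn_profile t ht).contDiffAt hn)]
    linarith
  hyperbolic t ht z hz := by
    have hS : Ioi (0 : ℝ) ×ˢ Icc (0 : ℝ) 1 ⊆ Ici 0 ×ˢ Icc 0 1 := prod_mono Ioi_subset_Ici_self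
      subset_rfl
    obtain ⟨f, -, hf⟩ := exists_time_derivative (hv.contDiffOn_snd.mono hS)
    obtain ⟨g, -, hg⟩ := exists_time_derivative (hu.contDiffOn_snd.mono hS)
    have hz' := Ioo_subset_Icc_self hz
    have h1 := hv.hyperbolic t ht z hz
    have h2 := hu.hyperbolic t ht z hz
    rw [(hf t ht z hz').deriv] at h1
    rw [(hg t ht z hz').deriv] at h2
    rw [((hf t ht z hz').fun_sub (hg t ht z hz')).deriv]
    linarith
  boundary_zero t ht := by rw [hv.boundary_zero t ht, hu.boundary_zero t ht, sub_self]
  boundary_one t ht := by rw [hv.boundary_one t ht, hu.boundary_one t ht, sub_self]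
  initial_fst z hz := by rw [hv.initial_fst z hz, hu.initial_fst z hz, sub_self]
  initial_snd z hz := by rw [hv.initial_snd z hz, hu.initial_snd z hz, sub_self]

/-! ### Existence and uniqueness -/

theorem theorem2p1 (K r a b : ℝ) (d u₁₀ u₂₀ : ℝ → ℝ)
    (hu₂₀ : ContDiffOn ℝ 1 u₂₀ (Icc 0 1))
    -- `u₁₀ ∈ H³(0,1)`, taken as its continuous representative on `[0,1]`
    (hu₁₀ : MemSobolevH 3 u₁₀) (hu₁₀_cont : ContinuousOn u₁₀ (Icc 0 1))
    (hu₁₀_one : u₁₀ 1 = 0)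
    (hu₁₀_zero : derivWithin u₁₀ (Icc 0 1) 0 = 0 ∨ iteratedDerivWithin 2 u₁₀ (Icc 0 1) 0 = 0)
    (hu₁₀_two : iteratedDerivWithin 2 u₁₀ (Icc 0 1) 1 = 0)
    (hd : ContDiffOn ℝ 2 d (Ici 0)) (hd_zero : d 0 = u₁₀ 0) :
    ∃ u₁ u₂ : ℝ → ℝ → ℝ,
      IsClassicalSolution K r a b d u₁₀ u₂₀ u₁ u₂ ∧
        ∀ v₁ v₂ : ℝ → ℝ → ℝ, IsClassicalSolution K r a b d u₁₀ u₂₀ v₁ v₂ →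
          ∀ t : ℝ, 0 ≤ t → ∀ z ∈ Icc (0 : ℝ) 1, v₁ t z = u₁ t z ∧ v₂ t z = u₂ t z := by
  obtain ⟨D, hD, hDe⟩ := hd.exists_contDiff_two_eqOn_Ici
  obtain ⟨U, hU, hUe⟩ := hu₂₀.exists_contDiff_one_eqOn_Icc
  obtain ⟨W, hW, hWe⟩ := hu₁₀.exists_contDiff_two_eqOn hu₁₀_cont
  obtain ⟨u₁, u₂, h⟩ := exists_classicalSolution K r a b hD hU hW
    ((hWe (right_mem_Icc.2 zero_le_one)).trans hu₁₀_one)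
    (by rw [hDe self_mem_Ici, hWe (left_mem_Icc.2 zero_le_one), hd_zero])
  have hsol : IsClassicalSolution K r a b d u₁₀ u₂₀ u₁ u₂ :=
    { h with
      boundary_zero := fun t ht => (h.boundary_zero t ht).trans (hDe ht)
      initial_fst := fun z hz => (h.initial_fst z hz).trans (hWe hz)
      initial_snd := fun z hz => (h.initial_snd z hz).trans (hUe hz) }
  refine ⟨u₁, u₂, hsol, fun v₁ v₂ hv t ht z hz => ?_⟩
  obtain ⟨h₁, h₂⟩ := (hv.sub hsol).eq_zero t ht z hz
  exact ⟨sub_eq_zero.1 h₁, sub_eq_zero.1 h₂⟩
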